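/- Let $m\in\mathbb{N}$ and let $\mathbf{G}(x,\mathbf{y})=(G_1,\dots,G_m)$ be formal power series with real coefficients in the variables $x,y_1,\dots,y_m$. Let $J_{\mathbf G}$ be the $m\times m$ matrix of the formal partial derivatives $\partial G_i/\partial y_j$. Suppose that the system $\mathbf{y}=\mathbf{G}(x,\mathbf{y})$ is *well-conditioned*, that is: (a) every $G_i$ has nonnegative coefficients; (b) $\mathbf{G}$ is holomorphic in a neighborhood of the origin; (c) $\mathbf{G}(0,\mathbf{y})=\mathbf{0}$; (d) $G_i(x,\mathbf{0})\neq 0$ for all $i$; (e) $\det(I-J_{\mathbf G}(0,\mathbf{0}))\neq 0$; (f) the matrix $J_{\mathbf G}$ is irreducible, that is, the directed graph on $\{1,\dots,m\}$ with an edge $i\to j$ whenever $\partial G_i/\partial y_j\neq 0$ has a path of positive length from every vertex to every vertex; (g) $\partial^2 G_i/\partial y_j\partial y_k\neq 0$ for some $i,j,k$. An *extreme point* of the system is a pair $(\rho,\boldsymbol{\tau})\in\mathbb{R}\times\mathbb{R}^m$ for which there are formal power series $\mathbf{T}(x)=(T_1(x),\dots,T_m(x))$ with nonnegative coefficients and zero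 constant terms such that $\mathbf{T}(x)=\mathbf{G}(x,\mathbf{T}(x))$ formally, every $T_i$ has radius of convergence $\rho\in(0,\infty)$, and every $T_i(\rho)$ converges, with sum $\tau_i$. A *characteristic point* of the system is a pair $(a,\mathbf{b})$ with $a>0$ and all $b_i>0$ at which all the series $G_i$ and all the formal derivatives $\partial G_i/\partial y_j$ converge and which satisfies $\mathbf{b}=\mathbf{G}(a,\mathbf{b})$ and $\det(I-J_{\mathbf G}(a,\mathbf{b}))=0$; it may lie on the boundary of the domain of convergence. Then the system has exactly one extreme point $(\rho,\boldsymbol{\tau})$, and for every characteristic point $(a,\mathbf{b})$ of the system, the largest real eigenvalue of $J_{\mathbf G}(a,\mathbf{b})$ equals $1$ if and only if $(a,\mathbf{b})=(\rho,\boldsymbol{\tau})$. -/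

import Mathlib

/-- A system `y_i = G_i(x, y_1, …, y_m)`, `i = 1, …, m`, given by `m` formal power series with real
coefficients in the variables `x` (the index `none`) and `y_j` (the index `some j`). -/
abbrev PSSystem (m : ℕ) : Type :=
  Fin m → MvPowerSeries (Option (Fin m)) ℝ

namespace PSSystem

/-- The term of the power series `F` with exponent `d`, evaluated at `p`: the coefficient times the
product of the `p s ^ d s`. -/
noncomputable def term {σ : Type*} (F : MvPowerSeries σ ℝ) (p : σ → ℝ) (d : σ →₀ ℕ) : ℝ :=
  MvPowerSeries.coeff d F * d.prod fun s k => p s ^ k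

/-- The point `(a, b)` as an assignment of values to the variables `x, y_1, …, y_m`. -/
def point {m : ℕ} (a : ℝ) (b : Fin m → ℝ) : Option (Fin m) → ℝ :=
  fun s => s.elim a b

/-- The formal Jacobian, the `m × m` matrix of the formal power series `∂ G_i / ∂ y_j`. -/
noncomputable def formalJacobian {m : ℕ} (G : PSSystem m) (i j : Fin m) :
    MvPowerSeries (Option (Fin m)) ℝ :=
  MvPowerSeries.pderiv ℝ (some j) (G i)

/-- The Jacobian matrix `J_G(a, b)`: the entries are the values at `(a, b)` of the formal partial
derivatives `∂ G_i / ∂ y_j`. (It is used only where all of these series converge.) -/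
noncomputable def jacobian {m : ℕ} (G : PSSystem m) (a : ℝ) (b : Fin m → ℝ) :
    Matrix (Fin m) (Fin m) ℝ :=
  Matrix.of fun i j => ∑' d, term (formalJacobian G i j) (point a b) d

/-- `μ` is the largest real eigenvalue of the real square matrix `M`. -/
def IsLargestRealEigenvalue {m : ℕ} (M : Matrix (Fin m) (Fin m) ℝ) (μ : ℝ) : Prop :=
  IsGreatest {t : ℝ | Module.End.HasEigenvalue (Matrix.toLin' M) t} μ

/-- Well-conditioned systems. -/
structure WellConditioned {m : ℕ} (G : PSSystem m) : Prop where
  /-- Every `G_i` has nonnegative coefficients. -/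
  nonneg : ∀ i d, 0 ≤ MvPowerSeries.coeff d (G i)
  /-- The series `G_i` define holomorphic functions in a neighbourhood of the origin, that is, they
  converge (absolutely) on a complex polydisc around the origin. -/
  holomorphic : ∃ r : ℝ, 0 < r ∧ ∀ i, ∀ z : Option (Fin m) → ℂ, (∀ s, ‖z s‖ < r) →
    Summable fun d : Option (Fin m) →₀ ℕ =>
      ((MvPowerSeries.coeff d (G i) : ℝ) : ℂ) * d.prod fun s k => z s ^ k
  /-- `G(0, y) = 0`. -/
  zero_left : ∀ i, ∀ d : Option (Fin m) →₀ ℕ, d none = 0 → MvPowerSeries.coeff d (G i) = 0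
  /-- `G_i(x, 0) ≠ 0` for all `i`. -/
  ne_zero_right : ∀ i, ∃ n : ℕ, MvPowerSeries.coeff (Finsupp.single none n) (G i) ≠ 0
  /-- `det (I - J_G(0, 0)) ≠ 0`. -/
  det_ne_zero : (1 - jacobian G 0 0).det ≠ 0
  /-- The nonnegative matrix `J_G` is irreducible: in the directed graph with an edge `i → j` whenever
  the entry `∂ G_i / ∂ y_j` is not zero, there is a path from any vertex to any vertex. -/
  irreducible : ∀ i j, Relation.TransGen (fun k l => formalJacobian G k l ≠ 0) i j
  /-- The system is nonlinear in `y`. -/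
  nonlinear : ∃ i j k, MvPowerSeries.pderiv ℝ (some k) (MvPowerSeries.pderiv ℝ (some j) (G i)) ≠ 0

/-- The standard solution: power series `T_i(x)` with nonnegative coefficients (and constant term
zero, as is needed for the formal composition) with the formal identity `T(x) = G(x, T(x))`. -/
structure IsStandardSolution {m : ℕ} (G : PSSystem m) (T : Fin m → PowerSeries ℝ) : Prop where
  nonneg : ∀ i n, 0 ≤ PowerSeries.coeff n (T i)
  constantCoeff_eq_zero : ∀ i, PowerSeries.constantCoeff (T i) = 0
  eq_subst : ∀ i, T i = MvPowerSeries.subst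
    (fun s : Option (Fin m) => s.elim (PowerSeries.X : PowerSeries ℝ) T) (G i)

/-- The radius of convergence of the power series `f` is the real number `ρ`. -/
def HasRadiusOfConvergence (f : PowerSeries ℝ) (ρ : ℝ) : Prop :=
  (∀ x : ℝ, |x| < ρ → Summable fun n : ℕ => PowerSeries.coeff n f * x ^ n) ∧
  (∀ x : ℝ, ρ < |x| → ¬ Summable fun n : ℕ => PowerSeries.coeff n f * x ^ n)

/-- `(ρ, τ)` is the extreme point of the system: `ρ > 0` is the common radius of convergence of the
components of the standard solution `T`, and every `T_i(ρ)` converges, with sum `τ_i`. -/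
def IsExtremePoint {m : ℕ} (G : PSSystem m) (ρ : ℝ) (τ : Fin m → ℝ) : Prop :=
  ∃ T : Fin m → PowerSeries ℝ, IsStandardSolution G T ∧ 0 < ρ ∧
    ∀ i, HasRadiusOfConvergence (T i) ρ ∧ HasSum (fun n : ℕ => PowerSeries.coeff n (T i) * ρ ^ n) (τ i)

/-- `(a, b)` is a characteristic point: a positive solution of the characteristic system
`y = G(x, y)`, `det (I - J_G(x, y)) = 0`; in particular all the series in it converge at `(a, b)`. -/
structure IsCharacteristicPoint {m : ℕ} (G : PSSystem m) (a : ℝ) (b : Fin m → ℝ) : Prop where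
  pos_left : 0 < a
  pos_right : ∀ i, 0 < b i
  hasSum : ∀ i, HasSum (term (G i) (point a b)) (b i)
  summable_jacobian : ∀ i j, Summable (term (formalJacobian G i j) (point a b))
  det_eq_zero : (1 - jacobian G a b).det = 0

end PSSystem

/-!
Everything is evaluated in `[0, ∞]`, so that no convergence question arises when series with
nonnegative coefficients are composed, differentiated or compared.

Since `G(0, y) = 0`, the map `T ↦ G(x, T)` is contracting for the `X`-adic topology; its fixed point
`T` is the limit of the iterates from `0`, so that `T(x) ≤ b` whenever `G(x, b) ≤ b`. Irreducibility
and nonlinearity give an inequality `c T_i(x)² ≤ T_i(x)`: the finite values of `T_i` are bounded,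
and all `T_i` converge exactly on one closed interval `[0, ρ]`. This gives the unique extreme point.

For `x < ρ`, the increment `T(ρ) - T(x) > 0` is a strict supersolution for the Jacobian at
`(x, T(x))`, whose eigenvalues are therefore less than `1`; by semicontinuity the eigenvalues at
`(ρ, T(ρ))` are at most `1`. Conversely, let `(a, b)` be a characteristic point at which no
eigenvalue exceeds `1`. By minimality `T(a) ≤ b`, and convexity gives `b - T(a) ≤ J (b - T(a))`. By
Perron-Frobenius this is an equality, and `b - T(a)` is zero or positive; the latter is excluded by
the strict convexity of the nonlinear component. So `b = T(a)`, and `a < ρ` is impossible because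
`1` is an eigenvalue.
-/

namespace PSSystem

section NonnegativeMatrix

open Matrix

variable {ι : Type*} {A B : Matrix ι ι ℝ} {v w x : ι → ℝ} {r : ℝ}

theorem isIrreducible_of_transGen [Finite ι] (hA : ∀ i j, 0 ≤ A i j)
    (h : ∀ i j, Relation.TransGen (fun k l => 0 < A k l) i j) : A.IsIrreducible := by
  classical
  have := Fintype.ofFinite ι
  refine (isIrreducible_iff_exists_pow_pos hA).2 fun i j => ?_
  induction h i j with
  | single hij => exact ⟨1, one_pos, by simpa using hij⟩
  | @tail k l _ hkl ih =>
    obtain ⟨n, -, hn⟩ := ih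
    refine ⟨n + 1, n.succ_pos, ?_⟩
    rw [pow_succ, mul_apply]
    exact Finset.sum_pos' (fun c _ => mul_nonneg (pow_apply_nonneg hA n i c) (hA c l))
      ⟨k, Finset.mem_univ k, mul_pos hn hkl⟩

variable [Fintype ι]

theorem eq_zero_of_le_mulVec_of_mulVec_lt (hA : ∀ i j, 0 ≤ A i j) (hv : ∀ i, 0 < v i)
    (hAv : ∀ i, (A *ᵥ v) i < v i) (hw : 0 ≤ w) (hAw : w ≤ A *ᵥ w) : w = 0 := by
  by_contra hw0
  obtain ⟨k, hk⟩ := Function.ne_iff.1 hw0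
  obtain ⟨i, -, hi⟩ :=
    Finset.exists_max_image Finset.univ (fun i => w i / v i) ⟨k, Finset.mem_univ k⟩
  set c := w i / v i
  have hc : 0 < c := (div_pos ((hw k).lt_of_ne' hk) (hv k)).trans_le (hi k (Finset.mem_univ k))
  have hle : w ≤ c • v := fun j => (div_le_iff₀ (hv j)).1 (hi j (Finset.mem_univ j))
  have : c * v i < c * v i := calc
    c * v i = w i := div_mul_cancel₀ _ (hv i).ne'
    _ ≤ (A *ᵥ w) i := hAw i
    _ ≤ (A *ᵥ (c • v)) i := dotProduct_le_dotProduct_of_nonneg_left hle (hA i)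
    _ = c * (A *ᵥ v) i := by rw [mulVec_smul, Pi.smul_apply, smul_eq_mul]
    _ < c * v i := mul_lt_mul_of_pos_left (hAv i) hc
  exact this.false

theorem mulVec_pos (hB : ∀ i j, 0 < B i j) (hx : 0 ≤ x) (hx0 : x ≠ 0) (i : ι) :
    0 < (B *ᵥ x) i := by
  obtain ⟨k, hk⟩ := Function.ne_iff.1 hx0
  exact Finset.sum_pos' (fun j _ => mul_nonneg (hB i j).le (hx j))
    ⟨k, Finset.mem_univ k, mul_pos (hB i k) ((hx k).lt_of_ne' hk)⟩

theorem le_sum_of_smul_le_mulVec (hA : ∀ i j, 0 ≤ A i j) (hx : x ∈ stdSimplex ℝ ι)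
    (h : r • x ≤ A *ᵥ x) : r ≤ ∑ i, ∑ j, A i j := calc
  r = ∑ i, r * x i := by rw [← Finset.mul_sum, hx.2, mul_one]
  _ ≤ ∑ i, ∑ j, A i j * x j := Finset.sum_le_sum fun i _ => h i
  _ ≤ ∑ i, ∑ j, A i j := Finset.sum_le_sum fun i _ => Finset.sum_le_sum fun j _ =>
    mul_le_of_le_one_right (hA i j)
      (hx.2 ▸ Finset.single_le_sum (fun k _ => hx.1 k) (Finset.mem_univ j))

theorem exists_mem_stdSimplex_smul_le_mulVec (hx : 0 ≤ x) (hx0 : x ≠ 0) (h : r • x ≤ A *ᵥ x) :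
    ∃ y ∈ stdSimplex ℝ ι, r • y ≤ A *ᵥ y := by
  obtain ⟨k, hk⟩ := Function.ne_iff.1 hx0
  have hsum : 0 < ∑ i, x i := Finset.sum_pos' (fun i _ => hx i)
    ⟨k, Finset.mem_univ k, (hx k).lt_of_ne' hk⟩
  refine ⟨(∑ i, x i)⁻¹ • x, ⟨fun i => mul_nonneg (inv_nonneg.2 hsum.le) (hx i), ?_⟩, ?_⟩
  · simp only [Pi.smul_apply, smul_eq_mul, ← Finset.mul_sum, inv_mul_cancel₀ hsum.ne']
  · rw [mulVec_smul, smul_comm]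
    exact smul_le_smul_of_nonneg_left h (inv_nonneg.2 hsum.le)

theorem exists_maximal_smul_le_mulVec (hA : ∀ i j, 0 ≤ A i j) (hx : 0 ≤ x) (hx0 : x ≠ 0)
    (h : r • x ≤ A *ᵥ x) :
    ∃ t ≥ r, ∃ y : ι → ℝ, 0 ≤ y ∧ y ≠ 0 ∧ t • y ≤ A *ᵥ y ∧
      ∀ s, ∀ z : ι → ℝ, 0 ≤ z → z ≠ 0 → s • z ≤ A *ᵥ z → s ≤ t := by
  classical
  set K : Set (ℝ × (ι → ℝ)) := (Set.Icc r (∑ i, ∑ j, A i j) ×ˢ stdSimplex ℝ ι) ∩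
    {p | p.1 • p.2 ≤ A *ᵥ p.2}
  have hKcompact : IsCompact K :=
    (isCompact_Icc.prod (isCompact_stdSimplex ℝ ι)).inter_right
      (isClosed_le (by fun_prop) (by fun_prop))
  have hmem : ∀ s ≥ r, ∀ z : ι → ℝ, 0 ≤ z → z ≠ 0 → s • z ≤ A *ᵥ z → ∃ y, (s, y) ∈ K := by
    intro s hs z hz hz0 hsz
    obtain ⟨y, hy, hsy⟩ := exists_mem_stdSimplex_smul_le_mulVec hz hz0 hsz
    exact ⟨y, ⟨⟨hs, le_sum_of_smul_le_mulVec hA hy hsy⟩, hy⟩, hsy⟩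
  obtain ⟨y₀, hy₀⟩ := hmem r le_rfl x hx hx0 h
  obtain ⟨⟨t, y⟩, hty, hmax⟩ := hKcompact.exists_isMaxOn ⟨_, hy₀⟩ continuous_fst.continuousOn
  refine ⟨t, hty.1.1.1, y, hty.1.2.1, ?_, hty.2, fun s z hz hz0 hsz => ?_⟩
  · rintro rfl
    simpa using hty.1.2.2
  · rcases le_total r s with hrs | hsr
    · obtain ⟨y', hy'⟩ := hmem s hrs z hz hz0 hsz
      exact hmax hy'
    · exact hsr.trans hty.1.1.1

theorem exists_commute_forall_pos (hA : A.IsIrreducible) :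
    ∃ B : Matrix ι ι ℝ, Commute A B ∧ ∀ i j, 0 < B i j := by
  classical
  choose n _ hn using (isIrreducible_iff_exists_pow_pos hA.nonneg).1 hA
  refine ⟨∑ k, ∑ l, A ^ n k l, .sum_right _ _ _ fun k _ => .sum_right _ _ _ fun l _ =>
    .self_pow A _, fun i j => ?_⟩
  have hnonneg : ∀ k l, 0 ≤ (A ^ n k l) i j := fun k l => pow_apply_nonneg hA.nonneg _ i j
  simp only [Matrix.sum_apply]
  exact Finset.sum_pos' (fun k _ => Finset.sum_nonneg fun l _ => hnonneg k l)
    ⟨i, Finset.mem_univ i, Finset.sum_pos' (fun l _ => hnonneg i l)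
      ⟨j, Finset.mem_univ j, hn i j⟩⟩

theorem exists_gt_smul_le_mulVec (hA : A.IsIrreducible) (hx : 0 ≤ x) (hx0 : x ≠ 0)
    (h : r • x ≤ A *ᵥ x) (hne : A *ᵥ x ≠ r • x) :
    ∃ s > r, ∃ y : ι → ℝ, 0 ≤ y ∧ y ≠ 0 ∧ s • y ≤ A *ᵥ y := by
  -- A positive matrix commuting with `A` makes the inequality strict in every coordinate.
  obtain ⟨B, hAB, hB⟩ := exists_commute_forall_pos hA
  have hy : ∀ i, 0 < (B *ᵥ x) i := mulVec_pos hB hx hx0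
  have hlt : ∀ i, r * (B *ᵥ x) i < (A *ᵥ (B *ᵥ x)) i := fun i => by
    have := mulVec_pos hB (sub_nonneg.2 h) (sub_ne_zero.2 hne) i
    rwa [mulVec_sub, mulVec_smul, mulVec_mulVec, ← hAB.eq, ← mulVec_mulVec, Pi.sub_apply,
      Pi.smul_apply, smul_eq_mul, sub_pos] at this
  have hev : ∀ᶠ s in nhdsWithin r (Set.Ioi r), ∀ i, s * (B *ᵥ x) i < (A *ᵥ (B *ᵥ x)) i :=
    Filter.eventually_all.2 fun i =>
      ((continuous_mul_const _).tendsto r).mono_left nhdsWithin_le_nhds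
        |>.eventually_lt_const (hlt i)
  obtain ⟨s, hs, hrs⟩ := (hev.and self_mem_nhdsWithin).exists
  obtain ⟨k, -⟩ := Function.ne_iff.1 hx0
  exact ⟨s, hrs, B *ᵥ x, fun i => (hy i).le, fun h0 => (hy k).ne' (congrFun h0 k),
    fun i => (hs i).le⟩

theorem pos_of_mulVec_eq_smul (hA : A.IsIrreducible) (hx : 0 ≤ x) (hx0 : x ≠ 0)
    (h : A *ᵥ x = r • x) (i : ι) : 0 < x i := by
  classical
  obtain ⟨j, hj⟩ := Function.ne_iff.1 hx0
  obtain ⟨k, -, hk⟩ := (isIrreducible_iff_exists_pow_pos hA.nonneg).1 hA i j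
  have hpow : ∀ n : ℕ, (A ^ n) *ᵥ x = r ^ n • x := by
    intro n
    induction n with
    | zero => simp
    | succ n ih => rw [pow_succ, ← mulVec_mulVec, h, mulVec_smul, ih, smul_smul, pow_succ']
  have hAx : 0 < ((A ^ k) *ᵥ x) i :=
    Finset.sum_pos' (fun l _ => mul_nonneg (pow_apply_nonneg hA.nonneg k i l) (hx l))
      ⟨j, Finset.mem_univ j, mul_pos hk ((hx j).lt_of_ne' hj)⟩
  rw [hpow] at hAx
  refine (hx i).lt_of_ne' fun hi => hAx.ne' ?_
  rw [Pi.smul_apply, hi, Pi.zero_apply, smul_zero]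

variable [DecidableEq ι]

theorem exists_hasEigenvalue_ge (hA : A.IsIrreducible) (hx : 0 ≤ x) (hx0 : x ≠ 0)
    (h : r • x ≤ A *ᵥ x) : ∃ t ≥ r, Module.End.HasEigenvalue (toLin' A) t := by
  obtain ⟨t, hrt, y, hy, hy0, hty, hmax⟩ := exists_maximal_smul_le_mulVec hA.nonneg hx hx0 h
  suffices hyt : A *ᵥ y = t • y from ⟨t, hrt, Module.End.hasEigenvalue_of_hasEigenvector (x := y)
    ⟨Module.End.mem_eigenspace_iff.2 (by rw [toLin'_apply, hyt]), hy0⟩⟩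
  by_contra hne
  obtain ⟨s, hs, z, hz, hz0, hsz⟩ := exists_gt_smul_le_mulVec hA hy hy0 hty hne
  exact hs.not_ge (hmax s z hz hz0 hsz)

theorem mulVec_eq_smul_of_smul_le_mulVec (hA : A.IsIrreducible)
    (hr : ∀ t, Module.End.HasEigenvalue (toLin' A) t → t ≤ r) (hx : 0 ≤ x)
    (h : r • x ≤ A *ᵥ x) : A *ᵥ x = r • x := by
  by_contra hne
  have hx0 : x ≠ 0 := by
    rintro rfl
    simp at hne
  obtain ⟨s, hrs, y, hy, hy0, hsy⟩ := exists_gt_smul_le_mulVec hA hx hx0 h hne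
  obtain ⟨t, hst, ht⟩ := exists_hasEigenvalue_ge hA hy hy0 hsy
  exact (hrs.trans_le hst).not_ge (hr t ht)

theorem exists_smul_le_mulVec_of_hasEigenvalue (hA : ∀ i j, 0 ≤ A i j)
    (hr : Module.End.HasEigenvalue (toLin' A) r) :
    ∃ y : ι → ℝ, 0 ≤ y ∧ y ≠ 0 ∧ r • y ≤ A *ᵥ y := by
  obtain ⟨y, hy⟩ := hr.exists_hasEigenvector
  have hAy : A *ᵥ y = r • y := by rw [← toLin'_apply, hy.apply_eq_smul]
  refine ⟨|y|, abs_nonneg y, (Pi.abs_eq_zero y).not.2 hy.2, fun i => ?_⟩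
  calc r * |y i| ≤ |r * y i| := by
        rw [abs_mul]
        exact mul_le_mul_of_nonneg_right (le_abs_self r) (abs_nonneg _)
    _ = |∑ j, A i j * y j| := congrArg abs (congrFun hAy i).symm
    _ ≤ ∑ j, |A i j * y j| := Finset.abs_sum_le_sum_abs _ _
    _ = ∑ j, A i j * |y j| := by simp only [abs_mul, abs_of_nonneg (hA i _)]

theorem hasEigenvalue_one_of_det_one_sub_eq_zero (hA : (1 - A).det = 0) :
    Module.End.HasEigenvalue (toLin' A) 1 := by
  obtain ⟨v, hv0, hv⟩ := exists_mulVec_eq_zero_iff.2 hA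
  rw [sub_mulVec, one_mulVec, sub_eq_zero] at hv
  exact Module.End.hasEigenvalue_of_hasEigenvector (x := v)
    ⟨Module.End.mem_eigenspace_iff.2 (by rw [toLin'_apply, ← hv, one_smul]), hv0⟩

end NonnegativeMatrix

section PolynomialTaylor

open MvPolynomial

variable {σ R : Type*} [Fintype σ] [CommSemiring R] (u h : σ → R) (q : MvPolynomial σ R)

theorem sum_eval_pderiv_mul_X_mul (p : σ → R) (t : σ) :
    ∑ s, eval p (pderiv s (q * X t)) * h s =
      (∑ s, eval p (pderiv s q) * h s) * p t + eval p q * h t := by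
  classical
  simp only [pderiv_mul, pderiv_X, map_add, map_mul, eval_X, add_mul, Finset.sum_add_distrib,
    Finset.sum_mul]
  congr 1
  · exact Finset.sum_congr rfl fun s _ => mul_right_comm _ _ _
  · rw [Finset.sum_eq_single t (fun s _ hs => by simp [Pi.single_eq_of_ne hs.symm]) (by simp)]
    simp

variable [PartialOrder R] [IsOrderedRing R] [CanonicallyOrderedAdd R]

theorem eval_add_le :
    eval (u + h) q ≤ eval u q + ∑ s, eval (u + h) (pderiv s q) * h s := by
  induction q using MvPolynomial.induction_on with
  | C c => simp
  | add q₁ q₂ ih₁ ih₂ =>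
    simp only [map_add, add_mul, Finset.sum_add_distrib]
    exact (add_le_add ih₁ ih₂).trans_eq (add_add_add_comm _ _ _ _)
  | mul_X q t ih =>
    rw [sum_eval_pderiv_mul_X_mul, map_mul, map_mul, eval_X, eval_X, Pi.add_apply]
    set S := ∑ s, eval (u + h) (pderiv s q) * h s
    calc eval (u + h) q * (u t + h t) = eval (u + h) q * u t + eval (u + h) q * h t := mul_add ..
      _ ≤ (eval u q + S) * u t + eval (u + h) q * h t := by gcongr
      _ ≤ (eval u q * u t + S * u t) + eval (u + h) q * h t + S * h t := by
        rw [add_mul]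
        exact le_self_add
      _ = eval u q * u t + (S * (u t + h t) + eval (u + h) q * h t) := by ring

theorem le_eval_add :
    eval u q + ∑ s, eval u (pderiv s q) * h s ≤ eval (u + h) q := by
  induction q using MvPolynomial.induction_on with
  | C c => simp
  | add q₁ q₂ ih₁ ih₂ =>
    simp only [map_add, add_mul, Finset.sum_add_distrib]
    exact (add_add_add_comm _ _ _ _).trans_le (add_le_add ih₁ ih₂)
  | mul_X q t ih =>
    rw [sum_eval_pderiv_mul_X_mul, map_mul, map_mul, eval_X, eval_X, Pi.add_apply]
    set S := ∑ s, eval u (pderiv s q) * h s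
    calc eval u q * u t + (S * u t + eval u q * h t)
        = (eval u q + S) * u t + eval u q * h t := by ring
      _ ≤ eval (u + h) q * u t + eval (u + h) q * h t :=
        add_le_add (mul_le_mul_left ih _) (mul_le_mul_left (le_self_add.trans ih) _)
      _ = eval (u + h) q * (u t + h t) := (mul_add ..).symm

end PolynomialTaylor

section ExtendedEvaluation

open MvPowerSeries
open scoped ENNReal

variable {σ τ : Type*} {F H : MvPowerSeries σ ℝ} {p q : σ → ℝ≥0∞}

/-- The semiring of power series with nonnegative coefficients. -/
def nonnegCoeffs (σ : Type*) : Subsemiring (MvPowerSeries σ ℝ) where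
  carrier := {F | ∀ d, 0 ≤ coeff d F}
  zero_mem' _ := by simp
  one_mem' d := by
    classical
    rw [coeff_one]
    split_ifs <;> norm_num
  add_mem' hF hH d := by
    rw [map_add]
    exact add_nonneg (hF d) (hH d)
  mul_mem' hF hH d := by
    classical
    rw [coeff_mul]
    exact Finset.sum_nonneg fun e _ => mul_nonneg (hF e.1) (hH e.2)

theorem X_mem_nonnegCoeffs (s : σ) : X s ∈ nonnegCoeffs σ := fun d => by
  classical
  rw [coeff_X]
  split_ifs <;> norm_num

theorem pderiv_mem_nonnegCoeffs (hF : F ∈ nonnegCoeffs σ) (s : σ) :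
    pderiv ℝ s F ∈ nonnegCoeffs σ := fun d => by
  rw [coeff_pderiv]
  exact mul_nonneg (hF _) (by positivity)

theorem finsuppProd_pow_mem_nonnegCoeffs {a : σ → MvPowerSeries τ ℝ}
    (ha : ∀ s, a s ∈ nonnegCoeffs τ) (d : σ →₀ ℕ) :
    (d.prod fun s k => a s ^ k) ∈ nonnegCoeffs τ :=
  prod_mem fun s _ => pow_mem (ha s) _

theorem subst_mem_nonnegCoeffs {a : σ → MvPowerSeries τ ℝ} (ha : HasSubst a)
    (hnonneg : ∀ s, a s ∈ nonnegCoeffs τ) (hF : F ∈ nonnegCoeffs σ) :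
    subst a F ∈ nonnegCoeffs τ := fun e => by
  rw [coeff_subst ha]
  exact finsum_nonneg fun d =>
    mul_nonneg (hF d) (finsuppProd_pow_mem_nonnegCoeffs hnonneg d e)

/-- The value in `[0, ∞]` of a power series with nonnegative coefficients (a negative coefficient
would count as `0`), at a point that may have infinite coordinates. -/
noncomputable def evalENNReal (F : MvPowerSeries σ ℝ) (p : σ → ℝ≥0∞) : ℝ≥0∞ :=
  ∑' d, ENNReal.ofReal (coeff d F) * d.prod fun s k => p s ^ k

theorem evalENNReal_mono (F : MvPowerSeries σ ℝ) : Monotone (evalENNReal F) := fun _ _ hpq =>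
  ENNReal.tsum_le_tsum fun _ =>
    mul_le_mul_right (Finset.prod_le_prod' fun s _ => pow_le_pow_left' (hpq s) _) _

theorem evalENNReal_zero : evalENNReal (0 : MvPowerSeries σ ℝ) p = 0 := by
  simp [evalENNReal]

theorem evalENNReal_one : evalENNReal (1 : MvPowerSeries σ ℝ) p = 1 := by
  classical
  rw [evalENNReal, tsum_eq_single 0 fun d hd => by simp [coeff_one, hd]]
  simp

theorem evalENNReal_X (s : σ) : evalENNReal (X s : MvPowerSeries σ ℝ) p = p s := by
  classical
  rw [evalENNReal, tsum_eq_single (Finsupp.single s 1) fun d hd => by simp [coeff_X, hd]]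
  simp

theorem evalENNReal_mul (hF : F ∈ nonnegCoeffs σ) (hH : H ∈ nonnegCoeffs σ) :
    evalENNReal (F * H) p = evalENNReal F p * evalENNReal H p := by
  classical
  simp only [evalENNReal]
  rw [← ENNReal.tsum_mul_right]
  simp only [← ENNReal.tsum_mul_left]
  rw [← ENNReal.tsum_prod, ← Finset.HasAntidiagonal.sigmaAntidiagonalEquivProd.tsum_eq,
    ENNReal.tsum_sigma']
  refine tsum_congr fun n => ?_
  rw [tsum_fintype, coeff_mul, ENNReal.ofReal_sum_of_nonneg fun e _ => mul_nonneg (hF _) (hH _),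
    Finset.sum_mul, ← Finset.sum_coe_sort]
  refine Finset.sum_congr rfl fun ⟨⟨k, l⟩, hkl⟩ _ => ?_
  obtain rfl := Finset.HasAntidiagonal.mem_antidiagonal.1 hkl
  rw [ENNReal.ofReal_mul (hF _), Finsupp.prod_add_index' (fun s => pow_zero _) fun s => pow_add _]
  exact mul_mul_mul_comm _ _ _ _

theorem evalENNReal_finsuppProd_pow {a : σ → MvPowerSeries τ ℝ} {x : τ → ℝ≥0∞}
    (ha : ∀ s, a s ∈ nonnegCoeffs τ) (d : σ →₀ ℕ) :
    evalENNReal (d.prod fun s k => a s ^ k) x = d.prod fun s k => evalENNReal (a s) x ^ k := by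
  let φ : nonnegCoeffs τ →* ℝ≥0∞ :=
    { toFun := fun F => evalENNReal F.1 x
      map_one' := evalENNReal_one
      map_mul' := fun F H => evalENNReal_mul F.2 H.2 }
  have hcoe : d.prod (fun s k => a s ^ k) =
      (d.prod fun s k => (⟨a s, ha s⟩ : nonnegCoeffs τ) ^ k : nonnegCoeffs τ) := by
    simp [Finsupp.prod]
  rw [hcoe]
  exact (map_finsuppProd φ d _).trans (by simp only [map_pow]; rfl)

theorem evalENNReal_subst {a : σ → MvPowerSeries τ ℝ} (ha : HasSubst a)
    (hnonneg : ∀ s, a s ∈ nonnegCoeffs τ) (hF : F ∈ nonnegCoeffs σ) (x : τ → ℝ≥0∞) :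
    evalENNReal (subst a F) x = evalENNReal F fun s => evalENNReal (a s) x := by
  have hterm : ∀ d e, 0 ≤ coeff d F * coeff e (d.prod fun s k => a s ^ k) := fun d e =>
    mul_nonneg (hF d) (finsuppProd_pow_mem_nonnegCoeffs hnonneg d e)
  have hcoeff : ∀ e, ENNReal.ofReal (coeff e (subst a F)) =
      ∑' d, ENNReal.ofReal (coeff d F * coeff e (d.prod fun s k => a s ^ k)) := fun e => by
    have hfin : (Function.support fun d =>
        coeff d F * coeff e (d.prod fun s k => a s ^ k)).Finite := coeff_subst_finite ha F e
    rw [coeff_subst ha]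
    simp only [smul_eq_mul]
    rw [finsum_eq_sum _ hfin, ENNReal.ofReal_sum_of_nonneg fun d _ => hterm d e]
    refine (tsum_eq_sum fun d hd => ?_).symm
    rw [Function.notMem_support.1 (mt hfin.mem_toFinset.2 hd), ENNReal.ofReal_zero]
  calc evalENNReal (subst a F) x
      = ∑' e, ∑' d, ENNReal.ofReal (coeff d F * coeff e (d.prod fun s k => a s ^ k)) *
          e.prod fun s k => x s ^ k := by
        simp only [evalENNReal, hcoeff, ENNReal.tsum_mul_right]
    _ = ∑' d, ENNReal.ofReal (coeff d F) * evalENNReal (d.prod fun s k => a s ^ k) x := by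
        rw [ENNReal.tsum_comm]
        simp only [ENNReal.ofReal_mul (hF _), mul_assoc, ENNReal.tsum_mul_left, evalENNReal]
    _ = evalENNReal F fun s => evalENNReal (a s) x := by
        simp only [evalENNReal_finsuppProd_pow hnonneg]
        rfl

theorem evalENNReal_ne_zero (hF : F ∈ nonnegCoeffs σ) (hF0 : F ≠ 0) (hp : ∀ s, p s ≠ 0) :
    evalENNReal F p ≠ 0 := by
  obtain ⟨d, hd⟩ := (MvPowerSeries.ne_zero_iff_exists_coeff_ne_zero F).1 hF0
  refine fun h => mul_ne_zero ?_ ?_ (ENNReal.tsum_eq_zero.1 h d)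
  · exact (ENNReal.ofReal_pos.2 ((hF d).lt_of_ne' hd)).ne'
  · exact Finset.prod_ne_zero_iff.2 fun s _ => pow_ne_zero _ (hp s)

theorem evalENNReal_eq_tsum_eval :
    evalENNReal F p =
      ∑' d, MvPolynomial.eval p (MvPolynomial.monomial d (ENNReal.ofReal (coeff d F))) := by
  simp only [evalENNReal, MvPolynomial.eval_monomial]

theorem evalENNReal_pderiv (F : MvPowerSeries σ ℝ) (p : σ → ℝ≥0∞) (s : σ) :
    evalENNReal (pderiv ℝ s F) p = ∑' d, MvPolynomial.eval p
      (MvPolynomial.pderiv s (MvPolynomial.monomial d (ENNReal.ofReal (coeff d F)))) := by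
  have hinj : Function.Injective fun d : σ →₀ ℕ => d + Finsupp.single s 1 :=
    add_left_injective _
  rw [← hinj.tsum_eq]
  · refine tsum_congr fun d => ?_
    rw [coeff_pderiv, MvPolynomial.pderiv_monomial, MvPolynomial.eval_monomial,
      add_tsub_cancel_right, ENNReal.ofReal_mul' (by positivity)]
    congr 2
    rw [Finsupp.add_apply, Finsupp.single_eq_same, ← ENNReal.ofReal_natCast]
    push_cast
    rfl
  · intro d hd
    refine ⟨d - Finsupp.single s 1, tsub_add_cancel_of_le (Finsupp.single_le_iff.2 ?_)⟩
    refine Nat.one_le_iff_ne_zero.2 fun h0 => hd ?_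
    simp [h0]

variable (u h : σ → ℝ≥0∞)

theorem evalENNReal_add_le [Fintype σ] (F : MvPowerSeries σ ℝ) :
    evalENNReal F (u + h) ≤
      evalENNReal F u + ∑ s, evalENNReal (pderiv ℝ s F) (u + h) * h s := by
  simp only [evalENNReal_pderiv, ← ENNReal.tsum_mul_right]
  rw [← Summable.tsum_finsetSum fun _ _ => ENNReal.summable, evalENNReal_eq_tsum_eval,
    evalENNReal_eq_tsum_eval, ← ENNReal.tsum_add]
  exact ENNReal.tsum_le_tsum fun d => eval_add_le u h _

theorem le_evalENNReal_add [Fintype σ] (F : MvPowerSeries σ ℝ) :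
    evalENNReal F u + ∑ s, evalENNReal (pderiv ℝ s F) u * h s ≤ evalENNReal F (u + h) := by
  simp only [evalENNReal_pderiv, ← ENNReal.tsum_mul_right]
  rw [← Summable.tsum_finsetSum fun _ _ => ENNReal.summable, evalENNReal_eq_tsum_eval,
    evalENNReal_eq_tsum_eval, ← ENNReal.tsum_add]
  exact ENNReal.tsum_le_tsum fun d => le_eval_add u h _

theorem evalENNReal_pderiv_mul_le [Finite σ] (F : MvPowerSeries σ ℝ) (s : σ) :
    evalENNReal F u + evalENNReal (pderiv ℝ s F) u * h s ≤ evalENNReal F (u + h) := by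
  have := Fintype.ofFinite σ
  exact (add_le_add_right (Finset.single_le_sum_of_canonicallyOrdered
    (f := fun s => evalENNReal (pderiv ℝ s F) u * h s) (Finset.mem_univ s)) _).trans
    (le_evalENNReal_add u h F)

/-- The strict convexity of `F` in the direction `h`, quantified by one second derivative. -/
theorem evalENNReal_add_add_pderiv_pderiv_le [Fintype σ] (F : MvPowerSeries σ ℝ) (j k : σ) :
    evalENNReal F (u + h + h) + evalENNReal (pderiv ℝ k (pderiv ℝ j F)) (u + h) * h k * h j ≤
      evalENNReal F u + 2 * ∑ s, evalENNReal (pderiv ℝ s F) (u + h + h) * h s := by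
  set S₁ := ∑ s, evalENNReal (pderiv ℝ s F) (u + h) * h s with hS₁
  set S₂ := ∑ s, evalENNReal (pderiv ℝ s F) (u + h + h) * h s with hS₂
  set D := evalENNReal (pderiv ℝ k (pderiv ℝ j F)) (u + h)
  have hderiv : S₁ + D * h k * h j ≤ S₂ := by
    classical
    rw [hS₁, hS₂, ← Finset.add_sum_erase _ _ (Finset.mem_univ j),
      ← Finset.add_sum_erase _ _ (Finset.mem_univ j), add_right_comm, ← add_mul]
    exact add_le_add (mul_le_mul_left (evalENNReal_pderiv_mul_le (u + h) h _ k) _)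
      (Finset.sum_le_sum fun s _ => mul_le_mul_left (evalENNReal_mono _ le_self_add) _)
  calc evalENNReal F (u + h + h) + D * h k * h j
      ≤ evalENNReal F (u + h) + S₂ + D * h k * h j := by
        gcongr
        exact evalENNReal_add_le (u + h) h F
    _ ≤ evalENNReal F u + S₁ + S₂ + D * h k * h j := by
        gcongr
        exact evalENNReal_add_le u h F
    _ = evalENNReal F u + (S₁ + D * h k * h j + S₂) := by ring
    _ ≤ evalENNReal F u + (S₂ + S₂) := by gcongr
    _ = evalENNReal F u + 2 * S₂ := by rw [two_mul]

theorem exists_mul_le_evalENNReal [Finite σ] (hF : F ∈ nonnegCoeffs σ) {s : σ}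
    (hs : pderiv ℝ s F ≠ 0) (hp : ∀ t, p t ≠ 0) : ∃ c ≠ 0, ∀ q ≥ p, c * q s ≤ evalENNReal F q := by
  refine ⟨evalENNReal (pderiv ℝ s F) (fun t => p t / 2) / 2, ?_, fun q hpq => ?_⟩
  · exact (ENNReal.half_pos (evalENNReal_ne_zero (pderiv_mem_nonnegCoeffs hF s) hs fun t =>
      (ENNReal.half_pos (hp t)).ne')).ne'
  · have hhalf : (fun t => q t / 2) + (fun t => q t / 2) = q := funext fun t =>
      ENNReal.add_halves (q t)
    calc evalENNReal (pderiv ℝ s F) (fun t => p t / 2) / 2 * q s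
        = evalENNReal (pderiv ℝ s F) (fun t => p t / 2) * (q s / 2) := by
          simp only [div_eq_mul_inv]; ring
      _ ≤ evalENNReal (pderiv ℝ s F) (fun t => q t / 2) * (q s / 2) := by
          gcongr
          exact evalENNReal_mono _ fun t => ENNReal.div_le_div_right (hpq t) 2
      _ ≤ evalENNReal F q := by
          conv_rhs => rw [← hhalf]
          exact le_add_self.trans (evalENNReal_pderiv_mul_le _ _ F s)

theorem exists_mul_mul_le_evalENNReal [Finite σ] (hF : F ∈ nonnegCoeffs σ) {j k : σ}
    (hjk : pderiv ℝ k (pderiv ℝ j F) ≠ 0) (hp : ∀ t, p t ≠ 0) :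
    ∃ c ≠ 0, ∀ q ≥ p, c * (q j * q k) ≤ evalENNReal F q := by
  obtain ⟨c, hc, hle⟩ := exists_mul_le_evalENNReal (pderiv_mem_nonnegCoeffs hF j) hjk
    (p := fun t => p t / 2) fun t => (ENNReal.half_pos (hp t)).ne'
  refine ⟨c / 2 / 2, (ENNReal.half_pos (ENNReal.half_pos hc).ne').ne', fun q hpq => ?_⟩
  have hhalf : (fun t => q t / 2) + (fun t => q t / 2) = q := funext fun t =>
    ENNReal.add_halves (q t)
  calc c / 2 / 2 * (q j * q k) = c * (q k / 2) * (q j / 2) := by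
        simp only [div_eq_mul_inv]; ring
    _ ≤ evalENNReal (pderiv ℝ j F) (fun t => q t / 2) * (q j / 2) := by
        gcongr
        exact hle _ fun t => ENNReal.div_le_div_right (hpq t) 2
    _ ≤ evalENNReal F q := by
        conv_rhs => rw [← hhalf]
        exact le_add_self.trans (evalENNReal_pderiv_mul_le _ _ F j)

end ExtendedEvaluation

section PowerSeriesEvaluation

open scoped ENNReal

theorem evalENNReal_powerSeries (f : PowerSeries ℝ) (x : ℝ≥0∞) :
    evalENNReal f (fun _ => x) = ∑' n, ENNReal.ofReal (PowerSeries.coeff n f) * x ^ n := by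
  rw [evalENNReal, ← (Finsupp.uniqueEquiv ()).symm.tsum_eq]
  refine tsum_congr fun n => ?_
  have hsingle : (Finsupp.uniqueEquiv ()).symm n = Finsupp.single () n :=
    (Equiv.symm_apply_eq _).2 (by simp)
  rw [hsingle, Finsupp.prod_single_index (h := fun _ k => x ^ k) (pow_zero x)]
  rfl

theorem lowerSemicontinuous_evalENNReal (f : PowerSeries ℝ) :
    LowerSemicontinuous fun x : ℝ≥0∞ => evalENNReal f fun _ => x := by
  simp only [evalENNReal_powerSeries]
  exact lowerSemicontinuous_tsum fun n => Continuous.lowerSemicontinuous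
    ((ENNReal.continuous_const_mul ENNReal.ofReal_ne_top).comp (ENNReal.continuous_pow n))

theorem evalENNReal_le_of_forall_coeff {f : PowerSeries ℝ} {x b : ℝ≥0∞} {g : ℕ → PowerSeries ℝ}
    (hcoeff : ∀ n, PowerSeries.X ^ n ∣ f - g n) (hle : ∀ n, evalENNReal (g n) (fun _ => x) ≤ b) :
    evalENNReal f (fun _ => x) ≤ b := by
  simp only [evalENNReal_powerSeries] at hle ⊢
  rw [ENNReal.tsum_eq_iSup_nat]
  refine iSup_le fun n => le_trans ?_ (hle n)
  refine (Finset.sum_congr rfl fun k hk => ?_).trans_le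
    (ENNReal.sum_le_tsum (Finset.range n))
  have := PowerSeries.X_pow_dvd_iff.1 (hcoeff n) k (Finset.mem_range.1 hk)
  rw [sub_eq_zero.1 ((map_sub _ _ _).symm.trans this)]

theorem X_pow_dvd_subst_sub {σ R : Type*} [CommRing R] {a b : σ → PowerSeries R}
    (ha : MvPowerSeries.HasSubst a) (hb : MvPowerSeries.HasSubst b) {n : ℕ}
    (h : ∀ s, PowerSeries.X ^ n ∣ a s - b s) (F : MvPowerSeries σ R) :
    (PowerSeries.X : PowerSeries R) ^ n ∣ MvPowerSeries.subst a F - MvPowerSeries.subst b F := by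
  have hprod : ∀ d : σ →₀ ℕ, (PowerSeries.X : PowerSeries R) ^ n ∣
      (d.prod fun s k => a s ^ k) - d.prod fun s k => b s ^ k := fun d => by
    simp only [← Ideal.mem_span_singleton, ← Ideal.Quotient.eq, map_finsuppProd, map_pow] at h ⊢
    simp only [h]
  refine PowerSeries.X_pow_dvd_iff.2 fun k hk => ?_
  rw [map_sub, sub_eq_zero, PowerSeries.coeff, MvPowerSeries.coeff_subst ha,
    MvPowerSeries.coeff_subst hb]
  refine finsum_congr fun d => congrArg _ (sub_eq_zero.1 ?_)
  rw [← map_sub]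
  exact PowerSeries.X_pow_dvd_iff.1 (hprod d) k hk

end PowerSeriesEvaluation

section FormalSolution

open scoped ENNReal

variable {m : ℕ} {G : PSSystem m} {S T : Fin m → PowerSeries ℝ}
  {F : MvPowerSeries (Option (Fin m)) ℝ}

/-- The formal curve `(x, T(x))`, the point at which `G` is composed with `T`. -/
noncomputable def formalCurve (T : Fin m → PowerSeries ℝ) (s : Option (Fin m)) : PowerSeries ℝ :=
  s.elim PowerSeries.X T

theorem hasSubst_formalCurve (hT : ∀ i, PowerSeries.constantCoeff (T i) = 0) :
    MvPowerSeries.HasSubst (formalCurve T) :=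
  MvPowerSeries.hasSubst_of_constantCoeff_zero fun s => by
    cases s with
    | none => exact MvPowerSeries.constantCoeff_X ()
    | some i => exact hT i

theorem formalCurve_mem_nonnegCoeffs (hT : ∀ i, T i ∈ nonnegCoeffs Unit) (s : Option (Fin m)) :
    formalCurve T s ∈ nonnegCoeffs Unit := by
  cases s with
  | none => exact X_mem_nonnegCoeffs ()
  | some i => exact hT i

theorem WellConditioned.X_dvd (hG : G.WellConditioned) (i : Fin m) :
    MvPowerSeries.X none ∣ G i :=
  MvPowerSeries.X_dvd_iff.2 (hG.zero_left i)

theorem X_dvd_subst_formalCurve (hT : ∀ i, PowerSeries.constantCoeff (T i) = 0)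
    (hF : MvPowerSeries.X none ∣ F) :
    PowerSeries.X ∣ MvPowerSeries.subst (formalCurve T) F := by
  obtain ⟨H, rfl⟩ := hF
  have hsub := hasSubst_formalCurve hT
  rw [MvPowerSeries.subst_mul hsub, MvPowerSeries.subst_X hsub]
  exact dvd_mul_right _ _

/-- The factor `x` of `G` makes `T ↦ G(x, T)` contracting for the `X`-adic topology. -/
theorem X_pow_succ_dvd_subst_sub (hS : ∀ i, PowerSeries.constantCoeff (S i) = 0)
    (hT : ∀ i, PowerSeries.constantCoeff (T i) = 0) (hF : MvPowerSeries.X none ∣ F) {n : ℕ}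
    (h : ∀ i, PowerSeries.X ^ n ∣ S i - T i) :
    PowerSeries.X ^ (n + 1) ∣
      MvPowerSeries.subst (formalCurve S) F - MvPowerSeries.subst (formalCurve T) F := by
  obtain ⟨H, rfl⟩ := hF
  have hsubS := hasSubst_formalCurve hS
  have hsubT := hasSubst_formalCurve hT
  rw [MvPowerSeries.subst_mul hsubS, MvPowerSeries.subst_mul hsubT,
    MvPowerSeries.subst_X hsubS, MvPowerSeries.subst_X hsubT, formalCurve, formalCurve,
    Option.elim_none, Option.elim_none, ← mul_sub, pow_succ']
  refine mul_dvd_mul_left _ (X_pow_dvd_subst_sub hsubS hsubT (fun s => ?_) H)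
  cases s with
  | none => simp [formalCurve]
  | some j => exact h j

/-- The iterates of `T ↦ G(x, T)` from `0`. -/
noncomputable def iterate (G : PSSystem m) : ℕ → Fin m → PowerSeries ℝ
  | 0 => 0
  | n + 1 => fun i => MvPowerSeries.subst (formalCurve (iterate G n)) (G i)

theorem constantCoeff_iterate (hG : ∀ i, MvPowerSeries.X none ∣ G i) (n : ℕ) (i : Fin m) :
    PowerSeries.constantCoeff (iterate G n i) = 0 := by
  induction n generalizing i with
  | zero => exact map_zero _
  | succ n ih => exact PowerSeries.X_dvd_iff.1 (X_dvd_subst_formalCurve ih (hG i))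

theorem iterate_mem_nonnegCoeffs (hG : G.WellConditioned) (n : ℕ) (i : Fin m) :
    iterate G n i ∈ nonnegCoeffs Unit := by
  induction n generalizing i with
  | zero => exact zero_mem _
  | succ n ih =>
    exact subst_mem_nonnegCoeffs (hasSubst_formalCurve (constantCoeff_iterate hG.X_dvd n))
      (formalCurve_mem_nonnegCoeffs ih) (hG.nonneg i)

theorem X_pow_dvd_iterate_sub_iterate (hG : ∀ i, MvPowerSeries.X none ∣ G i) {k n : ℕ}
    (hkn : k ≤ n) (i : Fin m) : PowerSeries.X ^ k ∣ iterate G n i - iterate G k i := by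
  induction k generalizing n i with
  | zero => exact (pow_zero (PowerSeries.X : PowerSeries ℝ)).symm ▸ one_dvd _
  | succ k ih =>
    obtain ⟨n, rfl⟩ := Nat.exists_eq_add_of_le' hkn
    exact X_pow_succ_dvd_subst_sub (constantCoeff_iterate hG _) (constantCoeff_iterate hG _)
      (hG i) (ih (Nat.le_of_succ_le_succ hkn))

theorem IsStandardSolution.X_pow_dvd_sub_iterate (hG : ∀ i, MvPowerSeries.X none ∣ G i)
    (hT : IsStandardSolution G T) (n : ℕ) (i : Fin m) :
    PowerSeries.X ^ n ∣ T i - iterate G n i := by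
  induction n generalizing i with
  | zero => exact (pow_zero (PowerSeries.X : PowerSeries ℝ)).symm ▸ one_dvd _
  | succ n ih =>
    rw [hT.eq_subst i]
    exact X_pow_succ_dvd_subst_sub hT.constantCoeff_eq_zero (constantCoeff_iterate hG n) (hG i) ih

theorem eq_of_forall_X_pow_dvd_sub {R : Type*} [Ring R] {f g : PowerSeries R}
    (h : ∀ n, PowerSeries.X ^ n ∣ f - g) : f = g := by
  ext n
  rw [← sub_eq_zero, ← map_sub]
  exact PowerSeries.X_pow_dvd_iff.1 (h (n + 1)) n n.lt_succ_self

theorem IsStandardSolution.unique (hG : ∀ i, MvPowerSeries.X none ∣ G i)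
    (hS : IsStandardSolution G S) (hT : IsStandardSolution G T) : S = T :=
  funext fun i => eq_of_forall_X_pow_dvd_sub fun n => by
    simpa using dvd_sub (hS.X_pow_dvd_sub_iterate hG n i) (hT.X_pow_dvd_sub_iterate hG n i)

theorem exists_isStandardSolution (hG : G.WellConditioned) :
    ∃ T : Fin m → PowerSeries ℝ, IsStandardSolution G T := by
  set T : Fin m → PowerSeries ℝ :=
    fun i => PowerSeries.mk fun n => PowerSeries.coeff n (iterate G (n + 1) i) with hTdef
  have hdvd : ∀ n i, PowerSeries.X ^ n ∣ T i - iterate G n i := fun n i => by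
    refine PowerSeries.X_pow_dvd_iff.2 fun k hk => ?_
    have := PowerSeries.X_pow_dvd_iff.1 (X_pow_dvd_iterate_sub_iterate hG.X_dvd hk i) k
      k.lt_succ_self
    rw [map_sub] at this ⊢
    rw [hTdef, PowerSeries.coeff_mk, ← neg_sub, this, neg_zero]
  have hT0 : ∀ i, PowerSeries.constantCoeff (T i) = 0 := fun i => by
    rw [hTdef, ← PowerSeries.coeff_zero_eq_constantCoeff_apply, PowerSeries.coeff_mk,
      PowerSeries.coeff_zero_eq_constantCoeff_apply, constantCoeff_iterate hG.X_dvd]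
  refine ⟨T, fun i n => ?_, hT0, fun i => eq_of_forall_X_pow_dvd_sub fun n => ?_⟩
  · rw [hTdef, PowerSeries.coeff_mk]
    exact iterate_mem_nonnegCoeffs hG _ i _
  · refine (pow_dvd_pow _ n.le_succ).trans ?_
    have := dvd_sub (hdvd (n + 1) i)
      (X_pow_succ_dvd_subst_sub hT0 (constantCoeff_iterate hG.X_dvd n) (hG.X_dvd i) (hdvd n))
    rwa [iterate, sub_sub_sub_cancel_right] at this

/-- The value `T(x)` of a family of power series, in `[0, ∞]`. -/
noncomputable def value (T : Fin m → PowerSeries ℝ) (x : ℝ≥0∞) (i : Fin m) : ℝ≥0∞ :=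
  evalENNReal (T i) fun _ => x

/-- The point `(x, T(x))`, with coordinates in `[0, ∞]`. -/
noncomputable def curve (T : Fin m → PowerSeries ℝ) (x : ℝ≥0∞) (s : Option (Fin m)) : ℝ≥0∞ :=
  s.elim x (value T x)

theorem value_mono (T : Fin m → PowerSeries ℝ) : Monotone (value T) := fun _ _ hxy i =>
  evalENNReal_mono (T i) fun _ => hxy

theorem curve_mono (T : Fin m → PowerSeries ℝ) : Monotone (curve T) := fun _ _ hxy s => by
  cases s with
  | none => exact hxy
  | some i => exact value_mono T hxy i

theorem evalENNReal_subst_formalCurve (hT0 : ∀ i, PowerSeries.constantCoeff (T i) = 0)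
    (hT : ∀ i, T i ∈ nonnegCoeffs Unit) (hF : F ∈ nonnegCoeffs (Option (Fin m))) (x : ℝ≥0∞) :
    evalENNReal (MvPowerSeries.subst (formalCurve T) F) (fun _ => x) =
      evalENNReal F (curve T x) := by
  rw [evalENNReal_subst (hasSubst_formalCurve hT0) (formalCurve_mem_nonnegCoeffs hT) hF]
  congr 1
  funext s
  cases s with
  | none => exact evalENNReal_X ()
  | some i => rfl

theorem IsStandardSolution.mem_nonnegCoeffs (hT : IsStandardSolution G T) (i : Fin m) :
    T i ∈ nonnegCoeffs Unit := fun d => by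
  rw [Finsupp.unique_single d]
  exact hT.nonneg i (d default)

theorem IsStandardSolution.evalENNReal_curve (hT : IsStandardSolution G T) {i : Fin m}
    (hG : G i ∈ nonnegCoeffs (Option (Fin m))) (x : ℝ≥0∞) :
    evalENNReal (G i) (curve T x) = value T x i := by
  rw [← evalENNReal_subst_formalCurve hT.constantCoeff_eq_zero hT.mem_nonnegCoeffs hG, value]
  exact congrArg (evalENNReal · _) (hT.eq_subst i).symm

theorem value_iterate_le (hG : G.WellConditioned) {x : ℝ≥0∞} {b : Fin m → ℝ≥0∞}
    (hb : ∀ i, evalENNReal (G i) (·.elim x b) ≤ b i) (n : ℕ) : value (iterate G n) x ≤ b := by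
  induction n with
  | zero => exact fun i => evalENNReal_zero.trans_le zero_le
  | succ n ih =>
    intro i
    refine (evalENNReal_subst_formalCurve (constantCoeff_iterate hG.X_dvd n)
      (iterate_mem_nonnegCoeffs hG n) (hG.nonneg i) x).trans_le
        ((evalENNReal_mono _ fun s => ?_).trans (hb i))
    cases s with
    | none => exact le_rfl
    | some j => exact ih j

theorem IsStandardSolution.value_le (hG : G.WellConditioned) (hT : IsStandardSolution G T)
    {x : ℝ≥0∞} {b : Fin m → ℝ≥0∞} (hb : ∀ i, evalENNReal (G i) (·.elim x b) ≤ b i) :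
    value T x ≤ b := fun i =>
  evalENNReal_le_of_forall_coeff (hT.X_pow_dvd_sub_iterate hG.X_dvd · i)
    fun n => value_iterate_le hG hb n i

end FormalSolution

section RealValues

open scoped ENNReal

theorem tsum_ofReal_ne_top_iff {α : Type*} {f : α → ℝ} (hf : ∀ a, 0 ≤ f a) :
    ∑' a, ENNReal.ofReal (f a) ≠ ⊤ ↔ Summable f :=
  ⟨fun h => by simpa only [ENNReal.toReal_ofReal (hf _)] using ENNReal.summable_toReal h,
    Summable.tsum_ofReal_ne_top⟩

theorem tsum_ofReal_eq_ofReal_iff {α : Type*} {f : α → ℝ} (hf : ∀ a, 0 ≤ f a) {v : ℝ}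
    (hv : 0 ≤ v) : ∑' a, ENNReal.ofReal (f a) = ENNReal.ofReal v ↔ HasSum f v := by
  constructor
  · intro h
    have hs := (tsum_ofReal_ne_top_iff hf).1 (h.trans_ne ENNReal.ofReal_ne_top)
    rw [← ENNReal.ofReal_tsum_of_nonneg hf hs,
      ENNReal.ofReal_eq_ofReal_iff (tsum_nonneg hf) hv] at h
    exact h ▸ hs.hasSum
  · intro h
    rw [← ENNReal.ofReal_tsum_of_nonneg hf h.summable, h.tsum_eq]

section MvPowerSeries

variable {σ : Type*} {F : MvPowerSeries σ ℝ} {p : σ → ℝ}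

theorem term_nonneg (hF : F ∈ nonnegCoeffs σ) (hp : ∀ s, 0 ≤ p s) (d : σ →₀ ℕ) :
    0 ≤ term F p d :=
  mul_nonneg (hF d) (Finset.prod_nonneg fun s _ => pow_nonneg (hp s) _)

theorem evalENNReal_ofReal (hF : F ∈ nonnegCoeffs σ) (hp : ∀ s, 0 ≤ p s) :
    evalENNReal F (fun s => ENNReal.ofReal (p s)) = ∑' d, ENNReal.ofReal (term F p d) := by
  refine tsum_congr fun d => ?_
  rw [term, ENNReal.ofReal_mul (hF d), Finsupp.prod, Finsupp.prod,
    ENNReal.ofReal_prod_of_nonneg fun s _ => pow_nonneg (hp s) _]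
  simp only [ENNReal.ofReal_pow (hp _)]

theorem evalENNReal_ofReal_ne_top_iff (hF : F ∈ nonnegCoeffs σ) (hp : ∀ s, 0 ≤ p s) :
    evalENNReal F (fun s => ENNReal.ofReal (p s)) ≠ ⊤ ↔ Summable (term F p) := by
  rw [evalENNReal_ofReal hF hp, tsum_ofReal_ne_top_iff (term_nonneg hF hp)]

theorem evalENNReal_ofReal_eq_ofReal_iff (hF : F ∈ nonnegCoeffs σ) (hp : ∀ s, 0 ≤ p s) {v : ℝ}
    (hv : 0 ≤ v) :
    evalENNReal F (fun s => ENNReal.ofReal (p s)) = ENNReal.ofReal v ↔ HasSum (term F p) v := by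
  rw [evalENNReal_ofReal hF hp, tsum_ofReal_eq_ofReal_iff (term_nonneg hF hp) hv]

/-- Where the series diverges, both sides are the junk value `0`. -/
theorem toReal_evalENNReal_ofReal (hF : F ∈ nonnegCoeffs σ) (hp : ∀ s, 0 ≤ p s) :
    (evalENNReal F fun s => ENNReal.ofReal (p s)).toReal = ∑' d, term F p d := by
  rw [evalENNReal_ofReal hF hp, ENNReal.tsum_toReal_eq fun _ => ENNReal.ofReal_ne_top]
  simp only [ENNReal.toReal_ofReal (term_nonneg hF hp _)]

end MvPowerSeries

section PowerSeries

variable {f : PowerSeries ℝ} {x : ℝ}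

theorem evalENNReal_powerSeries_ofReal (hf : ∀ n, 0 ≤ PowerSeries.coeff n f) (hx : 0 ≤ x) :
    evalENNReal f (fun _ => ENNReal.ofReal x) =
      ∑' n, ENNReal.ofReal (PowerSeries.coeff n f * x ^ n) := by
  simp only [evalENNReal_powerSeries, ENNReal.ofReal_mul (hf _), ENNReal.ofReal_pow hx]

theorem summable_coeff_mul_pow_iff (hf : ∀ n, 0 ≤ PowerSeries.coeff n f) :
    (Summable fun n => PowerSeries.coeff n f * x ^ n) ↔
      evalENNReal f (fun _ => ENNReal.ofReal |x|) ≠ ⊤ := by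
  rw [evalENNReal_powerSeries_ofReal hf (abs_nonneg x),
    tsum_ofReal_ne_top_iff fun n => mul_nonneg (hf n) (pow_nonneg (abs_nonneg x) n),
    ← summable_abs_iff]
  simp only [abs_mul, abs_pow, abs_of_nonneg (hf _)]

theorem hasSum_toReal_evalENNReal (hf : ∀ n, 0 ≤ PowerSeries.coeff n f) (hx : 0 ≤ x)
    (h : evalENNReal f (fun _ => ENNReal.ofReal x) ≠ ⊤) :
    HasSum (fun n => PowerSeries.coeff n f * x ^ n)
      (evalENNReal f fun _ => ENNReal.ofReal x).toReal := by
  rw [← tsum_ofReal_eq_ofReal_iff (fun n => mul_nonneg (hf n) (pow_nonneg hx n))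
    ENNReal.toReal_nonneg, ENNReal.ofReal_toReal h, evalENNReal_powerSeries_ofReal hf hx]

theorem hasRadiusOfConvergence_of_evalENNReal (hf : ∀ n, 0 ≤ PowerSeries.coeff n f) {ρ : ℝ}
    (hρ : 0 ≤ ρ) (h : ∀ x, evalENNReal f (fun _ => x) ≠ ⊤ ↔ x ≤ ENNReal.ofReal ρ) :
    HasRadiusOfConvergence f ρ := by
  simp only [HasRadiusOfConvergence, summable_coeff_mul_pow_iff hf, h]
  exact ⟨fun x hx => ENNReal.ofReal_le_ofReal hx.le,
    fun x hx hle => hx.not_ge ((ENNReal.ofReal_le_ofReal_iff hρ).1 hle)⟩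

theorem HasRadiusOfConvergence.le {r s : ℝ} (hs : 0 ≤ s) (hfr : HasRadiusOfConvergence f r)
    (hfs : HasRadiusOfConvergence f s) : r ≤ s := by
  by_contra! hlt
  obtain ⟨x, hsx, hxr⟩ := exists_between hlt
  have hx : |x| = x := abs_of_pos (hs.trans_lt hsx)
  exact hfs.2 x (hx.symm ▸ hsx) (hfr.1 x (hx.symm ▸ hxr))

end PowerSeries

end RealValues

section Radius

open scoped ENNReal

variable {m : ℕ} {G : PSSystem m} {T : Fin m → PowerSeries ℝ} {x x₀ : ℝ≥0∞}

theorem IsStandardSolution.value_ne_zero (hG : G.WellConditioned) (hT : IsStandardSolution G T)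
    (hx : x ≠ 0) (i : Fin m) : value T x i ≠ 0 := by
  obtain ⟨n, hn⟩ := hG.ne_zero_right i
  rw [← hT.evalENNReal_curve (hG.nonneg i)]
  refine fun h => mul_ne_zero ?_ ?_ (ENNReal.tsum_eq_zero.1 h (Finsupp.single none n))
  · exact (ENNReal.ofReal_pos.2 ((hG.nonneg i _).lt_of_ne' hn)).ne'
  · rw [Finsupp.prod_single_index (h := fun s k => curve T x s ^ k) (pow_zero _)]
    exact pow_ne_zero n hx

theorem IsStandardSolution.curve_ne_zero (hG : G.WellConditioned) (hT : IsStandardSolution G T)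
    (hx : x ≠ 0) (s : Option (Fin m)) : curve T x s ≠ 0 := by
  cases s with
  | none => exact hx
  | some i => exact hT.value_ne_zero hG hx i

theorem WellConditioned.pderiv_none_ne_zero (hG : G.WellConditioned) (i : Fin m) :
    MvPowerSeries.pderiv ℝ none (G i) ≠ 0 := by
  obtain ⟨n, hn⟩ := hG.ne_zero_right i
  cases n with
  | zero => exact absurd (hG.zero_left i _ (by simp)) hn
  | succ n =>
    refine fun h => hn ?_
    have hcoeff := congrArg (MvPowerSeries.coeff (Finsupp.single none n)) h
    rw [MvPowerSeries.coeff_pderiv, ← Finsupp.single_add, map_zero] at hcoeff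
    exact (mul_eq_zero.1 hcoeff).resolve_right (by positivity)

theorem IsStandardSolution.exists_mul_le_value (hG : G.WellConditioned)
    (hT : IsStandardSolution G T) (hx₀ : x₀ ≠ 0) (i : Fin m) :
    ∃ c ≠ 0, ∀ x ≥ x₀, c * x ≤ value T x i := by
  obtain ⟨c, hc, h⟩ := exists_mul_le_evalENNReal (hG.nonneg i) (hG.pderiv_none_ne_zero i)
    (hT.curve_ne_zero hG hx₀)
  exact ⟨c, hc, fun x hx =>
    (h _ (curve_mono T hx)).trans_eq (hT.evalENNReal_curve (hG.nonneg i) x)⟩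

theorem IsStandardSolution.exists_mul_value_le_value (hG : G.WellConditioned)
    (hT : IsStandardSolution G T) (hx₀ : x₀ ≠ 0) (i j : Fin m) :
    ∃ c ≠ 0, ∀ x ≥ x₀, c * value T x j ≤ value T x i := by
  have hedge : ∀ {k l}, formalJacobian G k l ≠ 0 →
      ∃ c ≠ 0, ∀ x ≥ x₀, c * value T x l ≤ value T x k := fun {k _} hkl => by
    obtain ⟨c, hc, h⟩ := exists_mul_le_evalENNReal (hG.nonneg k) hkl (hT.curve_ne_zero hG hx₀)
    exact ⟨c, hc, fun x hx =>
      (h _ (curve_mono T hx)).trans_eq (hT.evalENNReal_curve (hG.nonneg k) x)⟩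
  induction hG.irreducible i j with
  | single hij => exact hedge hij
  | tail _ hkl ih =>
    obtain ⟨c, hc, h⟩ := ih
    obtain ⟨c', hc', h'⟩ := hedge hkl
    exact ⟨c * c', mul_ne_zero hc hc', fun x hx =>
      (mul_assoc _ _ _).trans_le ((mul_le_mul_right (h' x hx) c).trans (h x hx))⟩

theorem IsStandardSolution.exists_mul_value_mul_value_le_value (hG : G.WellConditioned)
    (hT : IsStandardSolution G T) (hx₀ : x₀ ≠ 0) (i : Fin m) :
    ∃ c ≠ 0, ∀ x ≥ x₀, c * (value T x i * value T x i) ≤ value T x i := by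
  obtain ⟨l, j, k, hljk⟩ := hG.nonlinear
  obtain ⟨c, hc, h⟩ := exists_mul_mul_le_evalENNReal (hG.nonneg l) hljk (hT.curve_ne_zero hG hx₀)
  obtain ⟨cl, hcl, hl⟩ := hT.exists_mul_value_le_value hG hx₀ i l
  obtain ⟨cj, hcj, hj⟩ := hT.exists_mul_value_le_value hG hx₀ j i
  obtain ⟨ck, hck, hk⟩ := hT.exists_mul_value_le_value hG hx₀ k i
  refine ⟨cl * (c * (cj * ck)), mul_ne_zero hcl (mul_ne_zero hc (mul_ne_zero hcj hck)),
    fun x hx => ?_⟩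
  have hlx := h _ (curve_mono T hx)
  rw [hT.evalENNReal_curve (hG.nonneg l)] at hlx
  calc cl * (c * (cj * ck)) * (value T x i * value T x i)
      = cl * (c * ((cj * value T x i) * (ck * value T x i))) := by ring
    _ ≤ cl * (c * (value T x j * value T x k)) := by
      gcongr
      exacts [hj x hx, hk x hx]
    _ ≤ cl * value T x l := by gcongr; exact hlx
    _ ≤ value T x i := hl x hx

/-- A finite value `t = T_i(x)` satisfies `c t² ≤ t`, hence `t ≤ c⁻¹`. -/
theorem IsStandardSolution.exists_value_le (hG : G.WellConditioned) (hT : IsStandardSolution G T)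
    (hx₀ : x₀ ≠ 0) (i : Fin m) : ∃ M ≠ ⊤, ∀ x ≥ x₀, value T x i ≠ ⊤ → value T x i ≤ M := by
  obtain ⟨c, hc, h⟩ := hT.exists_mul_value_mul_value_le_value hG hx₀ i
  refine ⟨c⁻¹, ENNReal.inv_ne_top.2 hc, fun x hx hfin => ?_⟩
  have hne : value T x i ≠ 0 :=
    hT.value_ne_zero hG ((pos_iff_ne_zero.2 hx₀).trans_le hx).ne' i
  rw [ENNReal.le_inv_iff_mul_le, mul_comm, ← ENNReal.mul_le_mul_iff_left hne hfin, one_mul,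
    mul_assoc]
  exact h x hx

theorem WellConditioned.exists_ne_zero_evalENNReal_ne_top (hG : G.WellConditioned) :
    ∃ s : ℝ≥0∞, s ≠ 0 ∧ s ≠ ⊤ ∧ ∀ i, evalENNReal (G i) (fun _ => s) ≠ ⊤ := by
  obtain ⟨r, hr, h⟩ := hG.holomorphic
  have hr2 := half_pos hr
  refine ⟨ENNReal.ofReal (r / 2), (ENNReal.ofReal_pos.2 hr2).ne', ENNReal.ofReal_ne_top,
    fun i => ?_⟩
  refine (evalENNReal_ofReal_ne_top_iff (p := fun _ => r / 2) (hG.nonneg i) fun _ => hr2.le).2 ?_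
  refine Complex.summable_ofReal.1
    ((h i (fun _ => ((r / 2 : ℝ) : ℂ)) fun s => ?_).congr fun d => ?_)
  · rw [Complex.norm_real, Real.norm_of_nonneg hr2.le]
    exact half_lt_self hr
  · simp only [term, Finsupp.prod, Complex.ofReal_mul, Complex.ofReal_prod, Complex.ofReal_pow]

theorem WellConditioned.exists_eq_X_mul_mem_nonnegCoeffs (hG : G.WellConditioned) (i : Fin m) :
    ∃ H ∈ nonnegCoeffs (Option (Fin m)), G i = MvPowerSeries.X none * H := by
  obtain ⟨H, hH⟩ := hG.X_dvd i
  refine ⟨H, fun d => ?_, hH⟩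
  have := hG.nonneg i (Finsupp.single none 1 + d)
  rwa [hH, MvPowerSeries.X, MvPowerSeries.coeff_add_monomial_mul, one_mul] at this

/-- Since `G_i = x H_i`, the constant vector `s` is a supersolution of `y = G(x, y)` for small
`x`. -/
theorem IsStandardSolution.exists_ne_zero_value_ne_top (hG : G.WellConditioned)
    (hT : IsStandardSolution G T) : ∃ x ≠ 0, ∀ i, value T x i ≠ ⊤ := by
  obtain ⟨s, hs, hs_top, hfin⟩ := hG.exists_ne_zero_evalENNReal_ne_top
  choose H hH hGH using hG.exists_eq_X_mul_mem_nonnegCoeffs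
  have heval : ∀ i p, evalENNReal (G i) p = p none * evalENNReal (H i) p := fun i p => by
    rw [hGH i, evalENNReal_mul (X_mem_nonnegCoeffs none) (hH i), evalENNReal_X]
  set K := ∑ i, evalENNReal (H i) fun _ => s
  have hK_top : K ≠ ⊤ := ENNReal.sum_ne_top.2 fun i _ =>
    (ENNReal.lt_top_of_mul_ne_top_right (heval i (fun _ => s) ▸ hfin i) hs).ne
  have hx : min s (s / K) ≠ 0 :=
    (lt_min (pos_iff_ne_zero.2 hs) (ENNReal.div_pos hs hK_top)).ne'
  refine ⟨min s (s / K), hx, fun i => ne_top_of_le_ne_top hs_top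
    (hT.value_le hG (b := fun _ => s) (fun j => ?_) i)⟩
  calc evalENNReal (G j) (·.elim (min s (s / K)) fun _ => s)
      = min s (s / K) * evalENNReal (H j) (·.elim (min s (s / K)) fun _ => s) := heval j _
    _ ≤ s / K * K := by
      refine mul_le_mul' (min_le_right _ _) ((evalENNReal_mono (H j) fun t => ?_).trans
        (Finset.single_le_sum_of_canonicallyOrdered
          (f := fun i => evalENNReal (H i) fun _ => s) (Finset.mem_univ j)))
      cases t with
      | none => exact min_le_left _ _
      | some _ => exact le_rfl
    _ ≤ s := ENNReal.mul_le_of_le_div le_rfl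

theorem IsStandardSolution.value_ne_top (hG : G.WellConditioned) (hT : IsStandardSolution G T)
    {i : Fin m} (h : value T x i ≠ ⊤) (j : Fin m) : value T x j ≠ ⊤ := by
  obtain ⟨x₀, hx₀, hfin⟩ := hT.exists_ne_zero_value_ne_top hG
  rcases le_total x x₀ with hx | hx
  · exact ne_top_of_le_ne_top (hfin j) (value_mono T hx j)
  · obtain ⟨c, hc, hle⟩ := hT.exists_mul_value_le_value hG hx₀ i j
    exact (ENNReal.lt_top_of_mul_ne_top_right (ne_top_of_le_ne_top h (hle x hx)) hc).ne

/-- Lower semicontinuity and boundedness of the finite values make the set of convergence closed. -/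
theorem IsStandardSolution.exists_value_ne_top_iff (hG : G.WellConditioned)
    (hT : IsStandardSolution G T) :
    ∃ ρ : ℝ, 0 < ρ ∧ ∀ i x, value T x i ≠ ⊤ ↔ x ≤ ENNReal.ofReal ρ := by
  obtain ⟨i₀, -⟩ := hG.nonlinear
  obtain ⟨x₀, hx₀, hfin⟩ := hT.exists_ne_zero_value_ne_top hG
  obtain ⟨M, hM, hle⟩ := hT.exists_value_le hG hx₀ i₀
  obtain ⟨c, hc, hlin⟩ := hT.exists_mul_le_value hG hx₀ i₀
  set S := {x | value T x i₀ ≤ M}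
  have hx₀S : x₀ ∈ S := hle x₀ le_rfl (hfin i₀)
  have hmem : ∀ x, value T x i₀ ≠ ⊤ → x ∈ S := fun x hx => (le_total x₀ x).elim
    (fun hxx₀ => hle x hxx₀ hx) fun hxx₀ => (value_mono T hxx₀ i₀).trans hx₀S
  have hsup : sSup S ∈ S := ((lowerSemicontinuous_evalENNReal (T i₀)).isClosed_preimage M).sSup_mem
    ⟨x₀, hx₀S⟩
  have hx₀le : x₀ ≤ sSup S := le_sSup hx₀S
  have hsup_top : sSup S ≠ ⊤ := (ENNReal.lt_top_of_mul_ne_top_right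
    (ne_top_of_le_ne_top hM ((hlin _ hx₀le).trans hsup)) hc).ne
  refine ⟨(sSup S).toReal,
    ENNReal.toReal_pos ((pos_iff_ne_zero.2 hx₀).trans_le hx₀le).ne' hsup_top, fun i x => ?_⟩
  rw [ENNReal.ofReal_toReal hsup_top]
  exact ⟨fun h => le_sSup (hmem x (hT.value_ne_top hG h i₀)), fun h => hT.value_ne_top hG
    (ne_top_of_le_ne_top hM ((value_mono T h i₀).trans hsup)) i⟩

theorem IsStandardSolution.isExtremePoint_iff (hG : G.WellConditioned)
    (hT : IsStandardSolution G T) {ρ : ℝ} (hρ : 0 < ρ)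
    (h : ∀ i x, value T x i ≠ ⊤ ↔ x ≤ ENNReal.ofReal ρ) (r : ℝ) (t : Fin m → ℝ) :
    IsExtremePoint G r t ↔ (r, t) = (ρ, fun i => (value T (ENNReal.ofReal ρ) i).toReal) := by
  have hradius : ∀ i, HasRadiusOfConvergence (T i) ρ := fun i =>
    hasRadiusOfConvergence_of_evalENNReal (hT.nonneg i) hρ.le (h i)
  have hsum : ∀ i, HasSum (fun n => PowerSeries.coeff n (T i) * ρ ^ n)
      (value T (ENNReal.ofReal ρ) i).toReal := fun i =>
    hasSum_toReal_evalENNReal (hT.nonneg i) hρ.le ((h i _).2 le_rfl)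
  constructor
  · rintro ⟨T', hT', hr, hextreme⟩
    obtain rfl := hT'.unique hG.X_dvd hT
    obtain ⟨i₀, -⟩ := hG.nonlinear
    obtain rfl := ((hextreme i₀).1.le hρ.le (hradius i₀)).antisymm
      ((hradius i₀).le hr.le (hextreme i₀).1)
    exact Prod.ext rfl (funext fun i => (hextreme i).2.unique (hsum i))
  · intro hrt
    obtain ⟨rfl, rfl⟩ := Prod.mk.inj hrt
    exact ⟨T, hT, hρ, fun i => ⟨hradius i, hsum i⟩⟩

end Radius

section CharacteristicPoints

open Matrix Topology
open scoped ENNReal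

variable {m : ℕ} {G : PSSystem m} {T : Fin m → PowerSeries ℝ} {p : Option (Fin m) → ℝ≥0∞}
  {x y : ℝ≥0∞}

/-- The Jacobian matrix of `G` at a point with coordinates in `[0, ∞]`; it is meaningful only where
its entries converge, an infinite entry being replaced by `0`. -/
noncomputable def jacobianENNReal (G : PSSystem m) (p : Option (Fin m) → ℝ≥0∞) :
    Matrix (Fin m) (Fin m) ℝ :=
  of fun i j => (evalENNReal (formalJacobian G i j) p).toReal

theorem jacobianENNReal_nonneg (i j : Fin m) : 0 ≤ jacobianENNReal G p i j :=
  ENNReal.toReal_nonneg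

theorem WellConditioned.isIrreducible_jacobianENNReal (hG : G.WellConditioned) (hp : ∀ s, p s ≠ 0)
    (hfin : ∀ i j, evalENNReal (formalJacobian G i j) p ≠ ⊤) :
    (jacobianENNReal G p).IsIrreducible :=
  isIrreducible_of_transGen jacobianENNReal_nonneg fun i j =>
    Relation.TransGen.mono (fun k l hkl => ENNReal.toReal_pos
      (evalENNReal_ne_zero (pderiv_mem_nonnegCoeffs (hG.nonneg k) (some l)) hkl hp) (hfin k l))
      i j (hG.irreducible i j)

theorem jacobianENNReal_mulVec_toReal {h : Fin m → ℝ≥0∞} {i : Fin m}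
    (hfin : ∀ j, evalENNReal (formalJacobian G i j) p * h j ≠ ⊤) :
    (jacobianENNReal G p *ᵥ fun j => (h j).toReal) i =
      (∑ j, evalENNReal (formalJacobian G i j) p * h j).toReal := by
  rw [ENNReal.toReal_sum fun j _ => hfin j]
  simp only [ENNReal.toReal_mul]
  rfl

theorem IsStandardSolution.sum_formalJacobian_mul_sub_lt (hG : G.WellConditioned)
    (hT : IsStandardSolution G T) (hx : x ≠ 0) (hxy : x < y) {i : Fin m} (hy : value T y i ≠ ⊤) :
    ∑ j, evalENNReal (formalJacobian G i j) (curve T x) * (value T y j - value T x j) <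
      value T y i - value T x i := by
  have hle := le_evalENNReal_add (curve T x) (curve T y - curve T x) (G i)
  rw [add_tsub_cancel_of_le (curve_mono T hxy.le), hT.evalENNReal_curve (hG.nonneg i),
    hT.evalENNReal_curve (hG.nonneg i), Fintype.sum_option] at hle
  set S := ∑ j, evalENNReal (formalJacobian G i j) (curve T x) * (value T y j - value T x j)
  set X := evalENNReal (MvPowerSeries.pderiv ℝ none (G i)) (curve T x) * (y - x)
  have hX : X ≠ 0 := mul_ne_zero (evalENNReal_ne_zero (pderiv_mem_nonnegCoeffs (hG.nonneg i) none)
    (hG.pderiv_none_ne_zero i) (hT.curve_ne_zero hG hx)) (tsub_pos_of_lt hxy).ne'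
  have hXS : X + S ≤ value T y i - value T x i :=
    ENNReal.le_sub_of_add_le_left (ne_top_of_le_ne_top hy (value_mono T hxy.le i)) hle
  have hS : S ≠ ⊤ :=
    ne_top_of_le_ne_top (ne_top_of_le_ne_top hy tsub_le_self) (le_add_self.trans hXS)
  exact (ENNReal.lt_add_right hS hX).trans_le ((add_comm S X).trans_le hXS)

/-- For `v = T(y) - T(x)`, the Jacobian along the solution satisfies `J v < v`. -/
theorem IsStandardSolution.eq_zero_of_le_jacobianENNReal_mulVec (hG : G.WellConditioned)
    (hT : IsStandardSolution G T) (hx : x ≠ 0) (hxy : x < y) (hy : ∀ i, value T y i ≠ ⊤)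
    {w : Fin m → ℝ} (hw : 0 ≤ w) (hle : w ≤ jacobianENNReal G (curve T x) *ᵥ w) : w = 0 := by
  have hlt := fun i => hT.sum_formalJacobian_mul_sub_lt hG hx hxy (hy i)
  have hfin : ∀ i, value T y i - value T x i ≠ ⊤ := fun i =>
    ne_top_of_le_ne_top (hy i) tsub_le_self
  refine eq_zero_of_le_mulVec_of_mulVec_lt jacobianENNReal_nonneg
    (v := fun i => (value T y i - value T x i).toReal)
    (fun i => ENNReal.toReal_pos (zero_le.trans_lt (hlt i)).ne' (hfin i)) (fun i => ?_) hw hle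
  rw [jacobianENNReal_mulVec_toReal fun j =>
    ((ENNReal.sum_lt_top.1 ((hlt i).trans_le le_top)) j (Finset.mem_univ j)).ne]
  exact ENNReal.toReal_strict_mono (hfin i) (hlt i)

theorem lowerSemicontinuous_evalENNReal_curve
    (hT0 : ∀ i, PowerSeries.constantCoeff (T i) = 0) (hT : ∀ i, T i ∈ nonnegCoeffs Unit)
    {F : MvPowerSeries (Option (Fin m)) ℝ} (hF : F ∈ nonnegCoeffs (Option (Fin m))) :
    LowerSemicontinuous fun x => evalENNReal F (curve T x) := by
  simp only [← evalENNReal_subst_formalCurve hT0 hT hF]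
  exact lowerSemicontinuous_evalENNReal _

theorem IsStandardSolution.eventually_le_jacobianENNReal_mulVec
    (hG : ∀ i, G i ∈ nonnegCoeffs (Option (Fin m))) (hT : IsStandardSolution G T)
    (hfin : ∀ i j, evalENNReal (formalJacobian G i j) (curve T y) ≠ ⊤) {t : ℝ} (ht : 1 < t)
    {w : Fin m → ℝ} (hw : 0 ≤ w) (hle : t • w ≤ jacobianENNReal G (curve T y) *ᵥ w) :
    ∀ᶠ x in 𝓝[<] y, w ≤ jacobianENNReal G (curve T x) *ᵥ w := by
  set f : Fin m → ℝ≥0∞ → ℝ≥0∞ := fun i x =>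
    ∑ j, evalENNReal (formalJacobian G i j) (curve T x) * ENNReal.ofReal (w j)
  have hterm : ∀ x ≤ y, ∀ i j,
      evalENNReal (formalJacobian G i j) (curve T x) * ENNReal.ofReal (w j) ≠ ⊤ := fun x hxy i j =>
    ENNReal.mul_ne_top (ne_top_of_le_ne_top (hfin i j) (evalENNReal_mono _ (curve_mono T hxy)))
      ENNReal.ofReal_ne_top
  have hf_top : ∀ x ≤ y, ∀ i, f i x ≠ ⊤ := fun x hxy i =>
    ENNReal.sum_ne_top.2 fun j _ => hterm x hxy i j
  have hmulVec : ∀ x ≤ y, ∀ i, (jacobianENNReal G (curve T x) *ᵥ w) i = (f i x).toReal :=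
    fun x hxy i => by
      rw [← jacobianENNReal_mulVec_toReal (hterm x hxy i)]
      simp only [ENNReal.toReal_ofReal (hw _)]
  have hsemi : ∀ i, LowerSemicontinuous (f i) := fun i => lowerSemicontinuous_sum fun j _ =>
    (ENNReal.continuous_mul_const ENNReal.ofReal_ne_top).comp_lowerSemicontinuous
      (lowerSemicontinuous_evalENNReal_curve hT.constantCoeff_eq_zero hT.mem_nonnegCoeffs
        (pderiv_mem_nonnegCoeffs (hG i) (some j))) fun _ _ h => mul_le_mul_left h _
  have hnear : ∀ i, ∀ᶠ x in 𝓝 y, ENNReal.ofReal (w i) ≤ f i x := fun i => by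
    rcases (hw i).eq_or_lt with hwi | hwi
    · exact .of_forall fun x => by simp [← hwi]
    · have hfy : w i < (f i y).toReal :=
        (lt_mul_left hwi ht).trans_le ((hle i).trans_eq (hmulVec y le_rfl i))
      exact (hsemi i y _ ((ENNReal.ofReal_lt_iff_lt_toReal (hw i) (hf_top y le_rfl i)).2
        hfy)).mono fun _ => le_of_lt
  filter_upwards [nhdsWithin_le_nhds (Filter.eventually_all.2 hnear), self_mem_nhdsWithin]
    with x hx hxy i
  rw [hmulVec x (Set.mem_Iio.1 hxy).le]
  exact (ENNReal.ofReal_le_iff_le_toReal (hf_top x (Set.mem_Iio.1 hxy).le i)).1 (hx i)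

/-- An eigenvalue larger than `1` would leave a vector `w ≥ 0`, `w ≠ 0`, with `w ≤ J w` at some
`x < y`. -/
theorem IsStandardSolution.hasEigenvalue_jacobianENNReal_curve_le_one (hG : G.WellConditioned)
    (hT : IsStandardSolution G T) (hy0 : y ≠ 0) (hy : ∀ i, value T y i ≠ ⊤)
    (hfin : ∀ i j, evalENNReal (formalJacobian G i j) (curve T y) ≠ ⊤) {t : ℝ}
    (ht : Module.End.HasEigenvalue (toLin' (jacobianENNReal G (curve T y))) t) : t ≤ 1 := by
  by_contra! hlt
  obtain ⟨w, hw, hw0, hle⟩ := exists_smul_le_mulVec_of_hasEigenvalue jacobianENNReal_nonneg ht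
  have : (𝓝[<] y).NeBot := nhdsLT_neBot_of_exists_lt ⟨0, pos_iff_ne_zero.2 hy0⟩
  obtain ⟨x, hx, hx0, hxy⟩ :=
    ((hT.eventually_le_jacobianENNReal_mulVec hG.nonneg hfin hlt hw hle).and
      (Ioo_mem_nhdsLT (pos_iff_ne_zero.2 hy0))).exists
  exact hw0 (hT.eq_zero_of_le_jacobianENNReal_mulVec hG hx0.ne' hxy hy hw hx)

theorem IsStandardSolution.not_hasEigenvalue_jacobianENNReal_curve_one (hG : G.WellConditioned)
    (hT : IsStandardSolution G T) (hx : x ≠ 0) (hxy : x < y) (hy : ∀ i, value T y i ≠ ⊤) :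
    ¬ Module.End.HasEigenvalue (toLin' (jacobianENNReal G (curve T x))) 1 := fun h => by
  obtain ⟨w, hw, hw0, hle⟩ := exists_smul_le_mulVec_of_hasEigenvalue jacobianENNReal_nonneg h
  exact hw0 (hT.eq_zero_of_le_jacobianENNReal_mulVec hG hx hxy hy hw (by rwa [one_smul] at hle))

theorem IsStandardSolution.sub_le_sum_formalJacobian_mul_sub (hT : IsStandardSolution G T)
    {b : Fin m → ℝ≥0∞} (hle : value T x ≤ b) {i : Fin m}
    (hG : G i ∈ nonnegCoeffs (Option (Fin m)))
    (hGb : evalENNReal (G i) (·.elim x b) = b i) :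
    b i - value T x i ≤
      ∑ j, evalENNReal (formalJacobian G i j) (·.elim x b) * (b j - value T x j) := by
  have hadd : curve T x + (·.elim 0 fun j => b j - value T x j) = (·.elim x b) := funext fun s => by
    cases s with
    | none => exact add_zero x
    | some j => exact add_tsub_cancel_of_le (hle j)
  have := evalENNReal_add_le (curve T x) (·.elim 0 fun j => b j - value T x j) (G i)
  rw [hadd, hGb, hT.evalENNReal_curve (hG), Fintype.sum_option, Option.elim_none,
    mul_zero, zero_add] at this
  exact tsub_le_iff_left.2 this

theorem IsStandardSolution.sub_lt_sum_formalJacobian_mul_sub (hG : G.WellConditioned)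
    (hT : IsStandardSolution G T) (hx : x ≠ 0) {b : Fin m → ℝ≥0∞} (hlt : ∀ j, value T x j < b j)
    {i j k : Fin m}
    (hjk : MvPowerSeries.pderiv ℝ (some k) (MvPowerSeries.pderiv ℝ (some j) (G i)) ≠ 0)
    (hb : b i ≠ ⊤) (hGb : evalENNReal (G i) (·.elim x b) = b i) :
    b i - value T x i <
      ∑ j, evalENNReal (formalJacobian G i j) (·.elim x b) * (b j - value T x j) := by
  set δ : Option (Fin m) → ℝ≥0∞ := (·.elim 0 fun j => (b j - value T x j) / 2)
  have hadd : curve T x + δ + δ = (·.elim x b) := funext fun s => by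
    cases s with
    | none => simp [δ, curve]
    | some l =>
      exact (add_assoc _ _ _).trans
        ((congrArg _ (ENNReal.add_halves _)).trans (add_tsub_cancel_of_le (hlt l).le))
  have hδ : ∀ l, δ (some l) ≠ 0 := fun l => (ENNReal.half_pos (tsub_pos_of_lt (hlt l)).ne').ne'
  have hpos : evalENNReal (MvPowerSeries.pderiv ℝ (some k) (MvPowerSeries.pderiv ℝ (some j) (G i)))
      (curve T x + δ) * δ (some k) * δ (some j) ≠ 0 :=
    mul_ne_zero (mul_ne_zero (evalENNReal_ne_zero (pderiv_mem_nonnegCoeffs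
      (pderiv_mem_nonnegCoeffs (hG.nonneg i) _) _) hjk fun s =>
        ((pos_iff_ne_zero.2 (hT.curve_ne_zero hG hx s)).trans_le le_self_add).ne') (hδ k)) (hδ j)
  have hconvex := evalENNReal_add_add_pderiv_pderiv_le (curve T x) δ (G i) (some j) (some k)
  have hsum : 2 * ∑ s, evalENNReal (MvPowerSeries.pderiv ℝ s (G i)) (·.elim x b) * δ s =
      ∑ j, evalENNReal (formalJacobian G i j) (·.elim x b) * (b j - value T x j) := by
    have hδ_none : δ none = 0 := rfl
    rw [Fintype.sum_option, hδ_none, mul_zero, zero_add, Finset.mul_sum]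
    refine Finset.sum_congr rfl fun l _ => ?_
    have hδ_some : δ (some l) = (b l - value T x l) / 2 := rfl
    rw [mul_left_comm, hδ_some, ENNReal.mul_div_cancel two_ne_zero ENNReal.ofNat_ne_top]
    rfl
  rw [hadd, hGb, hT.evalENNReal_curve (hG.nonneg i), hsum] at hconvex
  exact (ENNReal.sub_lt_iff_lt_left (hlt i).ne_top (hlt i).le).2
    ((ENNReal.lt_add_right hb hpos).trans_le hconvex)

/-- If `b ≠ T(x)`, Perron-Frobenius turns `b - T(x) ≤ J (b - T(x))` into an equality, which
contradicts the strict convexity of the nonlinear component of `G`. -/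
theorem IsStandardSolution.value_eq_of_forall_hasEigenvalue_le_one (hG : G.WellConditioned)
    (hT : IsStandardSolution G T) (hx : x ≠ 0) {b : Fin m → ℝ≥0∞} (hb : ∀ i, b i ≠ ⊤)
    (hGb : ∀ i, evalENNReal (G i) (·.elim x b) = b i)
    (hfin : ∀ i j, evalENNReal (formalJacobian G i j) (·.elim x b) ≠ ⊤)
    (heig : ∀ t, Module.End.HasEigenvalue (toLin' (jacobianENNReal G (·.elim x b))) t → t ≤ 1) :
    value T x = b := by
  set h : Fin m → ℝ≥0∞ := fun i => b i - value T x i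
  have hle : value T x ≤ b := hT.value_le hG fun i => (hGb i).le
  have hh_top : ∀ i, h i ≠ ⊤ := fun i => ne_top_of_le_ne_top (hb i) tsub_le_self
  have hterm : ∀ i j, evalENNReal (formalJacobian G i j) (·.elim x b) * h j ≠ ⊤ := fun i j =>
    ENNReal.mul_ne_top (hfin i j) (hh_top j)
  have hsum : ∀ i, ∑ j, evalENNReal (formalJacobian G i j) (·.elim x b) * h j ≠ ⊤ := fun i =>
    ENNReal.sum_ne_top.2 fun j _ => hterm i j
  have hb0 : ∀ s, Option.elim s x b ≠ 0 := fun s => by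
    cases s with
    | none => exact hx
    | some i => exact ((pos_iff_ne_zero.2 (hT.value_ne_zero hG hx i)).trans_le (hle i)).ne'
  set J := jacobianENNReal G (·.elim x b)
  set v : Fin m → ℝ := fun i => (h i).toReal
  have hsub : (1 : ℝ) • v ≤ J *ᵥ v := fun i => by
    rw [one_smul, jacobianENNReal_mulVec_toReal (hterm i)]
    exact ENNReal.toReal_mono (hsum i)
      (hT.sub_le_sum_formalJacobian_mul_sub hle (hG.nonneg i) (hGb i))
  have hirr : J.IsIrreducible := hG.isIrreducible_jacobianENNReal hb0 hfin
  have hfix := mulVec_eq_smul_of_smul_le_mulVec hirr heig (fun i => ENNReal.toReal_nonneg) hsub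
  by_contra hne
  have hv0 : v ≠ 0 := fun hv0 => hne (hle.antisymm fun i => tsub_eq_zero_iff_le.1
    (((ENNReal.toReal_eq_zero_iff _).1 (congrFun hv0 i)).resolve_right (hh_top i)))
  have hlt : ∀ i, value T x i < b i := fun i => tsub_pos_iff_lt.1 (ENNReal.toReal_pos_iff.1
    (pos_of_mulVec_eq_smul hirr (fun i => ENNReal.toReal_nonneg) hv0 hfix i)).1
  obtain ⟨i, j, k, hjk⟩ := hG.nonlinear
  have hstrict := ENNReal.toReal_strict_mono (hsum i)
    (hT.sub_lt_sum_formalJacobian_mul_sub hG hx hlt hjk (hb i) (hGb i))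
  rw [← jacobianENNReal_mulVec_toReal (hterm i), hfix, one_smul] at hstrict
  exact hstrict.false

theorem IsStandardSolution.forall_hasEigenvalue_le_one_iff_value_eq (hG : G.WellConditioned)
    (hT : IsStandardSolution G T) (hx : x ≠ 0) {b : Fin m → ℝ≥0∞} (hb : ∀ i, b i ≠ ⊤)
    (hGb : ∀ i, evalENNReal (G i) (·.elim x b) = b i)
    (hfin : ∀ i j, evalENNReal (formalJacobian G i j) (·.elim x b) ≠ ⊤) :
    (∀ t, Module.End.HasEigenvalue (toLin' (jacobianENNReal G (·.elim x b))) t → t ≤ 1) ↔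
      value T x = b := by
  refine ⟨hT.value_eq_of_forall_hasEigenvalue_le_one hG hx hb hGb hfin, ?_⟩
  rintro rfl t ht
  exact hT.hasEigenvalue_jacobianENNReal_curve_le_one hG hx hb hfin ht

theorem IsStandardSolution.eq_of_hasEigenvalue_jacobianENNReal_curve_one (hG : G.WellConditioned)
    (hT : IsStandardSolution G T) (h : ∀ i x, value T x i ≠ ⊤ ↔ x ≤ y) (hx : x ≠ 0)
    (hfin : ∀ i, value T x i ≠ ⊤)
    (hone : Module.End.HasEigenvalue (toLin' (jacobianENNReal G (curve T x))) 1) : x = y := by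
  obtain ⟨i, -⟩ := hG.nonlinear
  exact ((h i x).1 (hfin i)).eq_of_not_lt fun hxy =>
    hT.not_hasEigenvalue_jacobianENNReal_curve_one hG hx hxy (fun j => (h j y).2 le_rfl) hone

theorem point_nonneg {a : ℝ} {b : Fin m → ℝ} (ha : 0 ≤ a) (hb : ∀ i, 0 ≤ b i)
    (s : Option (Fin m)) : 0 ≤ point a b s := by
  cases s with
  | none => exact ha
  | some i => exact hb i

theorem jacobianENNReal_ofReal_point (hG : ∀ i, G i ∈ nonnegCoeffs (Option (Fin m))) {a : ℝ}
    {b : Fin m → ℝ} (ha : 0 ≤ a) (hb : ∀ i, 0 ≤ b i) :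
    jacobianENNReal G (fun s => ENNReal.ofReal (point a b s)) = jacobian G a b :=
  Matrix.ext fun i j =>
    toReal_evalENNReal_ofReal (pderiv_mem_nonnegCoeffs (hG i) (some j)) (point_nonneg ha hb)

theorem ofReal_point (a : ℝ) (b : Fin m → ℝ) :
    (fun s => ENNReal.ofReal (point a b s)) =
      (·.elim (ENNReal.ofReal a) fun i => ENNReal.ofReal (b i)) :=
  funext fun s => by cases s <;> rfl

theorem IsCharacteristicPoint.evalENNReal_eq {a : ℝ} {b : Fin m → ℝ}
    (hc : IsCharacteristicPoint G a b) {i : Fin m} (hG : G i ∈ nonnegCoeffs (Option (Fin m))) :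
    evalENNReal (G i) (fun s => ENNReal.ofReal (point a b s)) = ENNReal.ofReal (b i) :=
  (evalENNReal_ofReal_eq_ofReal_iff hG
    (point_nonneg hc.pos_left.le fun k => (hc.pos_right k).le) (hc.pos_right i).le).2 (hc.hasSum i)

theorem IsCharacteristicPoint.evalENNReal_formalJacobian_ne_top {a : ℝ} {b : Fin m → ℝ}
    (hc : IsCharacteristicPoint G a b) {i : Fin m} (hG : G i ∈ nonnegCoeffs (Option (Fin m)))
    (j : Fin m) :
    evalENNReal (formalJacobian G i j) (fun s => ENNReal.ofReal (point a b s)) ≠ ⊤ :=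
  (evalENNReal_ofReal_ne_top_iff (pderiv_mem_nonnegCoeffs hG (some j))
    (point_nonneg hc.pos_left.le fun k => (hc.pos_right k).le)).2 (hc.summable_jacobian i j)

theorem IsStandardSolution.isLargestRealEigenvalue_jacobian_iff (hG : G.WellConditioned)
    (hT : IsStandardSolution G T) {ρ : ℝ} (hρ : 0 < ρ)
    (h : ∀ i x, value T x i ≠ ⊤ ↔ x ≤ ENNReal.ofReal ρ) {a : ℝ} {b : Fin m → ℝ}
    (hc : IsCharacteristicPoint G a b) :
    IsLargestRealEigenvalue (jacobian G a b) 1 ↔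
      (a, b) = (ρ, fun i => (value T (ENNReal.ofReal ρ) i).toReal) := by
  have hb : ∀ i, 0 ≤ b i := fun i => (hc.pos_right i).le
  have ha : ENNReal.ofReal a ≠ 0 := (ENNReal.ofReal_pos.2 hc.pos_left).ne'
  have hone := hasEigenvalue_one_of_det_one_sub_eq_zero hc.det_eq_zero
  have hGb := fun i => hc.evalENNReal_eq (hG.nonneg i)
  have hfin := fun i => hc.evalENNReal_formalJacobian_ne_top (hG.nonneg i)
  refine (and_iff_right hone).trans ?_
  rw [← jacobianENNReal_ofReal_point hG.nonneg hc.pos_left.le hb] at hone ⊢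
  simp only [ofReal_point] at hGb hfin hone ⊢
  refine (hT.forall_hasEigenvalue_le_one_iff_value_eq hG ha (fun i => ENNReal.ofReal_ne_top) hGb
    hfin).trans ⟨fun hval => ?_, fun hab => ?_⟩
  · rw [← hval] at hone
    have haρ : a = ρ := (ENNReal.ofReal_eq_ofReal_iff hc.pos_left.le hρ.le).1
      (hT.eq_of_hasEigenvalue_jacobianENNReal_curve_one hG h ha
        (fun i => ne_of_eq_of_ne (congrFun hval i) ENNReal.ofReal_ne_top) hone)
    rw [← haρ, hval]
    exact Prod.ext rfl (funext fun i => (ENNReal.toReal_ofReal (hb i)).symm)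
  · obtain ⟨rfl, rfl⟩ := Prod.mk.inj hab
    exact funext fun i => (ENNReal.ofReal_toReal ((h i _).2 le_rfl)).symm

end CharacteristicPoints

end PSSystem

theorem mainTheorem2 {m : ℕ} (G : PSSystem m) (hG : G.WellConditioned) :
    ∃ (ρ : ℝ) (τ : Fin m → ℝ),
      (∀ (r : ℝ) (t : Fin m → ℝ), PSSystem.IsExtremePoint G r t ↔ (r, t) = (ρ, τ)) ∧
      ∀ (a : ℝ) (b : Fin m → ℝ), PSSystem.IsCharacteristicPoint G a b →
        (PSSystem.IsLargestRealEigenvalue (PSSystem.jacobian G a b) 1 ↔ (a, b) = (ρ, τ)) := by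
  obtain ⟨T, hT⟩ := PSSystem.exists_isStandardSolution hG
  obtain ⟨ρ, hρ, h⟩ := hT.exists_value_ne_top_iff hG
  exact ⟨ρ, _, hT.isExtremePoint_iff hG hρ h,
    fun a b hc => hT.isLargestRealEigenvalue_jacobian_iff hG hρ h hc⟩
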